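/- Let $Q$ be a finite quiver, $k$ a field, and $kQ$ its path algebra, with paths composed from left to right (so $pq$ is "first $p$, then $q$"). Let $I$ be an admissible ideal of $kQ$: a two-sided ideal with $J^m\subseteq I\subseteq J^2$ for some $m\ge 2$, where $J$ is the ideal generated by the arrows. Put $\Lambda=kQ/I$. Let $a_i\colon v_{e_i}\to v_{f_i}$ $(i=1,\dots,t)$ be arrows of $Q$, and let $e_i,f_i$ also denote the idempotents of $\Lambda$ given by the trivial paths at the source and the target of $a_i$. Suppose that - there is a minimal set of generators of the two-sided ideal $I$ such that no $a_i$ occurs in any path appearing with nonzero coefficient in one of these generators, and - $\operatorname{Hom}_\Lambda(e_i\Lambda,f_j\Lambda)=0$ for all $i,j\in\{1,\dots,t\}$. Let $\Gamma=\Lambda/\Lambda\{\overline{a_i}\}_{i=1}^t\Lambda$ be the quotient of $\Lambda$ by the two-sided ideal generated by the residue classes of the arrows $a_i$. For a noetherian ring $R$ let $\operatorname{mod}R$ be the abelian category of finitely generated right $R$-modules. Then 1. $\operatorname{IT}(\Gamma)\le\operatorname{IT}(\Lambda)\le 2\operatorname{IT}(\Gamma)+1$; 2. $\dim\Gamma\le\dim\Lambda\le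 2\dim\Gamma+1$; 3. $\dim D^b(\operatorname{mod}\Gamma)\le\dim D^b(\operatorname{mod}\Lambda)\le 2\dim D^b(\operatorname{mod}\Gamma)+1$. Here all invariants take values in $\mathbb N\cup\{\infty\}$, with $\inf\emptyset=\infty$, and $\operatorname{add}\mathcal U$ denotes the class of direct summands of finite direct sums of objects of $\mathcal U$. - $\operatorname{IT}(R)$, the Igusa–Todorov distance, is the infimum of all $m\ge 0$ for which there are $n\ge 0$ and $U\in\operatorname{mod}R$ such that every $A\in\operatorname{mod}R$ admits an exact sequence $0\to U_m\to\cdots\to U_1\to U_0\to\Omega^n A\to 0$ with all $U_i\in\operatorname{add}U$; here $\Omega^nA$ is an $n$-th syzygy of $A$ ($\Omega^0A=A$, and $\Omega^{n+1}A$ is the kernel of an epimorphism from a projective object onto $\Omega^nA$). - $\dim R$, the extension dimension of $\operatorname{mod}R$, is the infimum of all $n\ge0$ with $\operatorname{mod}R=[T]_{n+1}$ for some $T$, where $[T]_1=\operatorname{add}T$ and, for $n\ge 2$, $[T]_n=\operatorname{add}\{A\mid \text{there is an exact sequence } 0\to X\to A\to Y\to 0 \text{ with } X\in[T]_1,\ Y\in[T]_{n-1}\}$.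 - $\dim\mathcal T$, the (Rouquier) dimension of a triangulated category $\mathcal T$, is the infimum of all $n\ge0$ with $\mathcal T=\langle T\rangle_{n+1}$ for some $T$, where $\langle T\rangle_1$ is the smallest full subcategory containing $T$ and closed under shifts, finite direct sums and direct summands, and $\langle T\rangle_{n+1}$ is the closure under these operations of the class of all $A$ in a distinguished triangle $X\to A\to Y\to X[1]$ with $X\in\langle T\rangle_1$, $Y\in\langle T\rangle_n$. -/

import Mathlib

open CategoryTheory CategoryTheory.Limits

noncomputable section

universe u v w

/-! ### The path algebra of a finite quiver -/

section PathAlgebra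

/-- Oriented paths of a quiver, with arbitrary source `p.1` and target `p.2.1`. -/
abbrev QuiverPath (V : Type v) [Quiver.{w} V] : Type max v w :=
  Σ (a b : V), Quiver.Path a b

/-- The path algebra `kQ`: formal `k`-linear combinations of the paths of the quiver. -/
def PathAlgebra (k : Type u) [Field k] (V : Type v) [Quiver.{w} V] : Type max u v w :=
  QuiverPath V →₀ k

namespace PathAlgebra

variable {k : Type u} [Field k] {V : Type v} [Quiver.{w} V]

instance : AddCommGroup (PathAlgebra k V) := inferInstanceAs (AddCommGroup (QuiverPath V →₀ k))

instance : Module k (PathAlgebra k V) := inferInstanceAs (Module k (QuiverPath V →₀ k))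

/-- A path as an element of the path algebra. -/
def ofPath (k : Type u) [Field k] (p : QuiverPath V) : PathAlgebra k V :=
  Finsupp.single p (1 : k)

/-- The paths that occur in an element of the path algebra with nonzero coefficient. -/
def paths (x : PathAlgebra k V) : Finset (QuiverPath V) := Finsupp.support x

/-- The trivial path at the vertex `a`. -/
def idem (k : Type u) [Field k] (a : V) : PathAlgebra k V :=
  ofPath k ⟨a, a, Quiver.Path.nil⟩

/-- An arrow as an element of the path algebra. -/
def arrow (k : Type u) [Field k] (α : Quiver.Total V) : PathAlgebra k V :=
  ofPath k ⟨α.left, α.right, α.hom.toPath⟩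

open Classical in
/-- The product of two paths: the concatenation "first `p`, then `q`" if `p` ends where `q`
starts, and zero otherwise. -/
def pathMul (k : Type u) [Field k] (p q : QuiverPath V) : PathAlgebra k V :=
  if h : p.2.1 = q.1 then ofPath k ⟨p.1, q.2.1, (p.2.2.cast rfl h).comp q.2.2⟩ else 0

/-- The bilinear extension of the product of paths. -/
def mulHom (k : Type u) [Field k] (V : Type v) [Quiver.{w} V] :
    PathAlgebra k V →ₗ[k] PathAlgebra k V →ₗ[k] PathAlgebra k V :=
  Finsupp.linearCombination k fun p : QuiverPath V =>
    (Finsupp.linearCombination k fun q : QuiverPath V => pathMul k p q :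
      (QuiverPath V →₀ k) →ₗ[k] PathAlgebra k V)

instance : Mul (PathAlgebra k V) := ⟨fun x y => mulHom k V x y⟩

lemma mul_eq (x y : PathAlgebra k V) : x * y = mulHom k V x y := rfl

lemma ofPath_mul_ofPath (p q : QuiverPath V) :
    ofPath k p * ofPath k q = pathMul k p q := by
  rw [mul_eq]
  unfold mulHom ofPath
  erw [Finsupp.linearCombination_single, one_smul, Finsupp.linearCombination_single, one_smul]

lemma ofPath_mul_of_eq {a b c : V} (p : Quiver.Path a b) (q : Quiver.Path b c) :
    ofPath k ⟨a, b, p⟩ * ofPath k ⟨b, c, q⟩ = ofPath k ⟨a, c, p.comp q⟩ := by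
  rw [ofPath_mul_ofPath]
  simp [pathMul]

lemma ofPath_mul_of_ne {a b b' c : V} (p : Quiver.Path a b) (q : Quiver.Path b' c)
    (h : b ≠ b') : ofPath k ⟨a, b, p⟩ * ofPath k ⟨b', c, q⟩ = 0 := by
  rw [ofPath_mul_ofPath]
  simp [pathMul, h]

lemma induction_paths {motive : PathAlgebra k V → Prop} (h0 : motive 0)
    (hadd : ∀ x y, motive x → motive y → motive (x + y))
    (hs : ∀ (r : k) (p : QuiverPath V), motive (r • ofPath k p)) (x : PathAlgebra k V) :
    motive x := by
  refine Finsupp.induction_linear (motive := motive) x h0 hadd fun p r => ?_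
  have : (Finsupp.single p r : QuiverPath V →₀ k) = r • Finsupp.single p (1 : k) := by simp
  rw [this]
  exact hs r p

lemma add_mul' (x y z : PathAlgebra k V) : (x + y) * z = x * z + y * z := by
  simp [mul_eq]

lemma mul_add' (x y z : PathAlgebra k V) : x * (y + z) = x * y + x * z := by
  simp [mul_eq]

lemma zero_mul' (x : PathAlgebra k V) : 0 * x = 0 := by simp [mul_eq]

lemma mul_zero' (x : PathAlgebra k V) : x * 0 = 0 := by simp [mul_eq]

lemma smul_mul' (r : k) (x y : PathAlgebra k V) : (r • x) * y = r • (x * y) := by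
  simp [mul_eq]

lemma mul_smul' (r : k) (x y : PathAlgebra k V) : x * (r • y) = r • (x * y) := by
  simp [mul_eq]

lemma mul_assoc_paths (p q r : QuiverPath V) :
    ofPath k p * ofPath k q * ofPath k r = ofPath k p * (ofPath k q * ofPath k r) := by
  obtain ⟨a, b, p⟩ := p
  obtain ⟨b', c, q⟩ := q
  obtain ⟨c', d, r⟩ := r
  by_cases h : b = b'
  · subst h
    by_cases h' : c = c'
    · subst h'
      simp only [ofPath_mul_of_eq, Quiver.Path.comp_assoc]
    · rw [ofPath_mul_of_eq, ofPath_mul_of_ne _ _ h', ofPath_mul_of_ne _ _ h', mul_zero']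
  · by_cases h' : c = c'
    · subst h'
      rw [ofPath_mul_of_eq, ofPath_mul_of_ne _ _ h, ofPath_mul_of_ne _ _ h, zero_mul']
    · rw [ofPath_mul_of_ne _ _ h, ofPath_mul_of_ne _ _ h', zero_mul', mul_zero']

lemma mul_assoc' (x y z : PathAlgebra k V) : x * y * z = x * (y * z) := by
  induction x using induction_paths with
  | h0 => simp only [zero_mul']
  | hadd x x' h h' => simp only [add_mul', h, h']
  | hs s p =>
    induction y using induction_paths with
    | h0 => simp only [zero_mul', mul_zero']
    | hadd x x' h h' => simp only [add_mul', mul_add', h, h']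
    | hs s' q =>
      induction z using induction_paths with
      | h0 => simp only [mul_zero']
      | hadd x x' h h' => simp only [mul_add', h, h']
      | hs s'' r => simp only [smul_mul', mul_smul', mul_assoc_paths]

variable [Fintype V]

/-- The unit of the path algebra of a quiver with finitely many vertices is the sum of all
trivial paths. -/
instance : One (PathAlgebra k V) := ⟨∑ a : V, idem k a⟩

lemma one_eq : (1 : PathAlgebra k V) = ∑ a : V, idem k a := rfl

lemma one_mul' (x : PathAlgebra k V) : 1 * x = x := by
  induction x using induction_paths with
  | h0 => exact mul_zero' _
  | hadd x x' h h' => rw [mul_add', h, h']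
  | hs s p =>
    obtain ⟨a, b, p⟩ := p
    rw [mul_smul', one_eq, mul_eq, map_sum, LinearMap.sum_apply]
    simp only [← mul_eq]
    rw [Finset.sum_eq_single a]
    · rw [idem, ofPath_mul_of_eq, Quiver.Path.nil_comp]
    · intro c _ hc
      exact ofPath_mul_of_ne _ _ hc
    · simp

lemma mul_one' (x : PathAlgebra k V) : x * 1 = x := by
  induction x using induction_paths with
  | h0 => exact zero_mul' _
  | hadd x x' h h' => rw [add_mul', h, h']
  | hs s p =>
    obtain ⟨a, b, p⟩ := p
    rw [smul_mul', one_eq, mul_eq, map_sum]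
    simp only [← mul_eq]
    rw [Finset.sum_eq_single b]
    · rw [idem, ofPath_mul_of_eq, Quiver.Path.comp_nil]
    · intro c _ hc
      exact ofPath_mul_of_ne _ _ (Ne.symm hc)
    · simp

instance : Ring (PathAlgebra k V) :=
  { (inferInstance : AddCommGroup (PathAlgebra k V)) with
    mul := (· * ·)
    one := 1
    left_distrib := mul_add'
    right_distrib := add_mul'
    zero_mul := zero_mul'
    mul_zero := mul_zero'
    mul_assoc := mul_assoc'
    one_mul := one_mul'
    mul_one := mul_one' }

instance : Algebra k (PathAlgebra k V) := Algebra.ofModule smul_mul' mul_smul'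

/-- The arrow ideal of `kQ`: the two-sided ideal generated by all arrows. -/
def arrowIdeal (k : Type u) [Field k] (V : Type v) [Quiver.{w} V] [Fintype V] :
    Ideal (PathAlgebra k V) :=
  (TwoSidedIdeal.span (Set.range fun α : Quiver.Total V => arrow k α)).asIdeal

/-- A two-sided ideal `I` of `kQ` is admissible if `J ^ m ⊆ I ⊆ J ^ 2` for some `m ≥ 2`, where
`J` is the arrow ideal. -/
class IsAdmissible (I : TwoSidedIdeal (PathAlgebra k V)) : Prop where
  exists_pow_le : ∃ m : ℕ, 2 ≤ m ∧ arrowIdeal k V ^ m ≤ I.asIdeal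
  le_sq : I.asIdeal ≤ arrowIdeal k V ^ 2

/-- The arrow `α` occurs in the path `p`. -/
def OccursIn (α : Quiver.Total V) (p : QuiverPath V) : Prop :=
  ∃ (p₁ : Quiver.Path p.1 α.left) (p₂ : Quiver.Path α.right p.2.1),
    p.2.2 = (p₁.cons α.hom).comp p₂

/-- `S` is a minimal set of generators of the two-sided ideal `I`. -/
def IsMinimalGeneratingSet (I : TwoSidedIdeal (PathAlgebra k V)) (S : Set (PathAlgebra k V)) :
    Prop :=
  Minimal (fun S' => TwoSidedIdeal.span S' = I) S

/-- The quotient algebra `Λ = kQ/I`. -/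
abbrev BoundAlgebra (I : TwoSidedIdeal (PathAlgebra k V)) : Type max u v w :=
  PathAlgebra k V ⧸ I.asIdeal

/-- The residue class in `kQ/I` of the trivial path at the vertex `a`. -/
def vertexIdem (I : TwoSidedIdeal (PathAlgebra k V)) (a : V) : BoundAlgebra I :=
  Ideal.Quotient.mk I.asIdeal (idem k a)

/-- The right `Λ`-module `e_a Λ`, where `Λ = kQ/I` and `e_a` is the idempotent of the
vertex `a`. -/
def vertexModule (I : TwoSidedIdeal (PathAlgebra k V)) (a : V) : Submodule (BoundAlgebra I)ᵐᵒᵖ (BoundAlgebra I) :=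
  Submodule.span (BoundAlgebra I)ᵐᵒᵖ {vertexIdem I a}

/-- The two-sided ideal of `Λ = kQ/I` generated by the residue classes of the arrows `a i`. -/
def removedIdeal (I : TwoSidedIdeal (PathAlgebra k V)) {ι : Type*} (a : ι → Quiver.Total V) :
    TwoSidedIdeal (BoundAlgebra I) :=
  TwoSidedIdeal.span (Set.range fun i => Ideal.Quotient.mk I.asIdeal (arrow k (a i)))

/-- The algebra `Γ = Λ/⟨a i⟩` obtained from `Λ = kQ/I` by removing the arrows `a i`. -/
abbrev ArrowRemoval (I : TwoSidedIdeal (PathAlgebra k V)) {ι : Type*}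
    (a : ι → Quiver.Total V) : Type max u v w :=
  BoundAlgebra I ⧸ (removedIdeal I a).asIdeal

/-! An admissible quotient of the path algebra of a finite quiver is finite-dimensional, hence
noetherian; so are its quotients. This is what makes their categories of finitely generated
modules abelian. -/

lemma arrow_mem_arrowIdeal (α : Quiver.Total V) : arrow k α ∈ arrowIdeal k V := by
  rw [arrowIdeal, TwoSidedIdeal.mem_asIdeal]
  exact TwoSidedIdeal.subset_span ⟨α, rfl⟩

lemma ofPath_mem_arrowIdeal_pow (m : ℕ) :
    ∀ {a b : V} (p : Quiver.Path a b), m ≤ p.length →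
      ofPath k ⟨a, b, p⟩ ∈ arrowIdeal k V ^ m := by
  induction m with
  | zero =>
    intro a b p _
    rw [Submodule.pow_zero, Ideal.one_eq_top]
    trivial
  | succ m ih =>
    intro a b p hp
    cases p with
    | nil => simp at hp
    | cons p α =>
      have h1 := ih p (by simpa using hp)
      have h2 := arrow_mem_arrowIdeal (k := k) (⟨_, _, α⟩ : Quiver.Total V)
      have h3 : ofPath k ⟨a, b, p.cons α⟩ = ofPath k ⟨_, _, p⟩ * arrow k ⟨_, _, α⟩ := by
        rw [arrow, ofPath_mul_of_eq]
        rfl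
      rw [h3, Submodule.pow_succ]
      exact Submodule.mul_mem_mul h1 h2

lemma finite_paths_of_length [∀ a b : V, Finite (a ⟶ b)] (n : ℕ) :
    {p : QuiverPath V | p.2.2.length = n}.Finite := by
  induction n with
  | zero =>
    refine (Set.finite_range fun a : V => (⟨a, a, Quiver.Path.nil⟩ : QuiverPath V)).subset ?_
    rintro ⟨a, b, p⟩ hp
    cases p with
    | nil => exact ⟨a, rfl⟩
    | cons p α => simp at hp
  | succ n ih =>
    have := ih.to_subtype
    refine (Set.finite_range fun x : (Σ (p : {p : QuiverPath V | p.2.2.length = n}) (c : V),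
      p.1.2.1 ⟶ c) => (⟨x.1.1.1, x.2.1, x.1.1.2.2.cons x.2.2⟩ : QuiverPath V)).subset ?_
    rintro ⟨a, b, p⟩ hp
    cases p with
    | nil => simp at hp
    | cons p α => exact ⟨⟨⟨⟨_, _, p⟩, by simpa using hp⟩, _, α⟩, rfl⟩

instance finite_boundAlgebra [∀ a b : V, Finite (a ⟶ b)] (I : TwoSidedIdeal (PathAlgebra k V))
    [IsAdmissible I] : Module.Finite k (BoundAlgebra I) := by
  obtain ⟨m, -, hm⟩ := IsAdmissible.exists_pow_le (I := I)
  let T : Set (QuiverPath V) := ⋃ n ∈ Set.Iio m, {p | p.2.2.length = n}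
  have hT : T.Finite := (Set.finite_Iio m).biUnion fun n _ => finite_paths_of_length n
  let f : QuiverPath V → BoundAlgebra I := fun p => Ideal.Quotient.mk I.asIdeal (ofPath k p)
  refine Module.Finite.of_fg_top ⟨(hT.image f).toFinset, ?_⟩
  rw [Set.Finite.coe_toFinset, eq_top_iff]
  rintro x -
  obtain ⟨x, rfl⟩ := Ideal.Quotient.mk_surjective x
  induction x using induction_paths with
  | h0 => rw [map_zero]; exact Submodule.zero_mem _
  | hadd x y hx hy => rw [map_add]; exact Submodule.add_mem _ hx hy
  | hs r p =>
    have : Ideal.Quotient.mk I.asIdeal (r • ofPath k p) = r • f p := rfl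
    rw [this]
    refine Submodule.smul_mem _ _ ?_
    by_cases hp : p.2.2.length < m
    · exact Submodule.subset_span ⟨p, by simpa [T] using hp, rfl⟩
    · have : f p = 0 :=
        Ideal.Quotient.eq_zero_iff_mem.2 (hm (ofPath_mem_arrowIdeal_pow m p.2.2 (not_lt.1 hp)))
      rw [this]
      exact Submodule.zero_mem _

instance isNoetherianRing_boundAlgebra [∀ a b : V, Finite (a ⟶ b)]
    (I : TwoSidedIdeal (PathAlgebra k V)) [IsAdmissible I] : IsNoetherianRing (BoundAlgebra I)ᵐᵒᵖ :=
  have : Module.Finite k (BoundAlgebra I)ᵐᵒᵖ := Module.Finite.equiv (MulOpposite.opLinearEquiv k)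
  isNoetherian_of_tower k (inferInstance : IsNoetherian k (BoundAlgebra I)ᵐᵒᵖ)

instance isNoetherianRing_arrowRemoval [∀ a b : V, Finite (a ⟶ b)]
    (I : TwoSidedIdeal (PathAlgebra k V)) [IsAdmissible I] {ι : Type*}
    (a : ι → Quiver.Total V) : IsNoetherianRing (ArrowRemoval I a)ᵐᵒᵖ :=
  isNoetherianRing_of_surjective _ _
    (RingHom.op (Ideal.Quotient.mk (removedIdeal I a).asIdeal))
    (fun x => by
      obtain ⟨y, hy⟩ := Ideal.Quotient.mk_surjective x.unop
      exact ⟨MulOpposite.op y, MulOpposite.unop_injective hy⟩)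

end PathAlgebra

end PathAlgebra

/-! ### Dimensions of abelian and triangulated categories -/

/-- The category of finitely generated right modules over a ring. -/
abbrev FGRightModuleCat (R : Type u) [Ring R] : Type (u + 1) := FGModuleCat.{u} Rᵐᵒᵖ

section Dimensions

attribute [local instance] Abelian.hasFiniteBiproducts

variable {C : Type u} [Category.{v} C] [Abelian C]

/-- `add U`: the direct summands of finite direct sums of objects in `U`. -/
def addClosure (U : ObjectProperty C) : ObjectProperty C := fun X =>
  ∃ (n : ℕ) (f : Fin n → C), (∀ i, U (f i)) ∧ Nonempty (Retract X (⨁ f))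

/-- `K` is an `n`-th syzygy of `X`: a `0`-th syzygy is `X` itself (up to isomorphism), and an
`(n + 1)`-st syzygy is the kernel of an epimorphism from a projective object onto an `n`-th
syzygy. -/
def IsSyzygy (X : C) : ℕ → C → Prop
  | 0, K => Nonempty (K ≅ X)
  | n + 1, K => ∃ S : ShortComplex C, S.ShortExact ∧ Nonempty (S.X₁ ≅ K) ∧ Projective S.X₂ ∧
      IsSyzygy X n S.X₃

/-- There is an exact sequence `0 ⟶ U_m ⟶ ⋯ ⟶ U_1 ⟶ U_0 ⟶ X ⟶ 0` with all `U_i` in `U` (a class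
of objects closed under isomorphisms). The exact sequence is given by the short exact sequences
`0 ⟶ X_{i+1} ⟶ U_i ⟶ X_i ⟶ 0`, with `X_0 = X` and `X_m = U_m`, that it consists of. -/
def HasExactResolution (U : ObjectProperty C) : ℕ → C → Prop
  | 0, X => U X
  | m + 1, X => ∃ S : ShortComplex C, S.ShortExact ∧ Nonempty (S.X₃ ≅ X) ∧ U S.X₂ ∧
      HasExactResolution U m S.X₁

variable (C) in
/-- `C` is an `(m, n)`-Igusa-Todorov category: there is an object `U` such that for every object
`A` there is an exact sequence `0 ⟶ U_m ⟶ ⋯ ⟶ U_0 ⟶ Ω^n A ⟶ 0` with all `U_i` in `add U`. -/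
def IsIgusaTodorovCategory (m n : ℕ) : Prop :=
  ∃ U : C, ∀ A : C, ∃ K : C, IsSyzygy A n K ∧
    HasExactResolution (addClosure (ObjectProperty.singleton U)) m K

variable (C) in
/-- The Igusa-Todorov distance of `C`: the infimum of all `m` such that `C` is an
`(m, n)`-Igusa-Todorov category for some `n` (`⊤` if there is none). -/
def igusaTodorovDistance : ℕ∞ :=
  ⨅ (m : ℕ) (_ : ∃ n : ℕ, IsIgusaTodorovCategory C m n), (m : ℕ∞)

/-- `U₁ • U₂`: the direct summands of finite direct sums of extensions `A`,
`0 ⟶ X₁ ⟶ A ⟶ X₂ ⟶ 0`, with `X₁` in `U₁` and `X₂` in `U₂`. -/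
def extensionProd (U₁ U₂ : ObjectProperty C) : ObjectProperty C :=
  addClosure fun A => ∃ S : ShortComplex C, S.ShortExact ∧ S.X₂ = A ∧ U₁ S.X₁ ∧ U₂ S.X₃

/-- `[U]_n`: `[U]_0 = 0`, `[U]_1 = add U` and `[U]_n = [U]_1 • [U]_{n-1}` for `n ≥ 2`. -/
def extensionLayer (U : ObjectProperty C) : ℕ → ObjectProperty C
  | 0 => fun X => IsZero X
  | 1 => addClosure U
  | n + 2 => extensionProd (addClosure U) (extensionLayer U (n + 1))

variable (C) in
/-- The extension dimension of `C`: the infimum of all `n` such that `C = [T]_{n+1}` for some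
object `T` (`⊤` if there is none). -/
def extensionDimension : ℕ∞ :=
  ⨅ (n : ℕ) (_ : ∃ T : C, extensionLayer (ObjectProperty.singleton T) (n + 1) = ⊤), (n : ℕ∞)

/-- The Rouquier dimension of a triangulated category: the infimum of all `n` such that
`𝒯 = ⟨T⟩_{n+1}` for some object `T` (`⊤` if there is none). In Mathlib, `⟨U⟩_{n+1}` is
`U.triangEnvelopeIter n`, as it counts the number `n` of extensions of objects of `⟨U⟩_1`. -/
def rouquierDimension (𝒯 : Type u) [Category.{v} 𝒯] [HasZeroObject 𝒯] [HasShift 𝒯 ℤ]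
    [Preadditive 𝒯] [∀ n : ℤ, (shiftFunctor 𝒯 n).Additive] [Pretriangulated 𝒯] : ℕ∞ :=
  ⨅ (n : ℕ) (_ : ∃ T : 𝒯, (ObjectProperty.singleton T).triangEnvelopeIter n = ⊤), (n : ℕ∞)

variable (C) in
/-- The Rouquier dimension of the bounded derived category of `C`. -/
def boundedDerivedDimension : ℕ∞ :=
  letI : HasDerivedCategory.{max u v} C := HasDerivedCategory.standard C
  rouquierDimension (DerivedCategory.Bounded C)

end Dimensions

end

/-! Write `K` for the two-sided ideal of `Λ` generated by the classes of the removed arrows. The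
hypotheses on the arrows give three facts, collected in `IsCleftExtension` (for the opposite rings,
because right modules are treated as left modules over the opposite ring).

(a) `Λ → Γ` has a ring section: some generators of `I` do not involve the removed arrows, so killing
these arrows and fixing everything else is a well-defined endomorphism of `Λ` (`retraction`), which
vanishes on `K`.

(b) `K² = 0`: the condition on homomorphisms says `f_j Λ e_i = 0`, while any product of two
generators of `K` contains a factor `a_j x a_i = a_j f_j x e_i a_i`.

(c) `K` is projective as a right `Λ`-module. Every element is a sum of terms `u α v` with `α`
removed, and such a term is determined by `α` and by `u ⊗ v` in `Λ e ⊗ f Λ`. The coordinates are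
extracted by a triangular action of `Λ` on `Λ × Λ` (`twistHom`, `coeffMap`), and `sum_mul_coeffMap`
is the resulting dual basis identity.

From here on only the cleft extension `R → S` with kernel `J` matters. Inflation `i : mod S → mod R`
and restriction along the section `e : mod R → mod S` are exact, and `e ∘ i` is the identity.
Applying `e` to resolutions, filtrations and triangles gives the lower bounds; for the Igusa–Todorov
distance `e` must also preserve projectives, which holds because `J` lies in `add (i S)`.

For the upper bounds, each `A` is an extension of `A / JA` by `JA`, and both are inflated since `J²
= 0`. Two filtrations or triangle constructions with `n + 1` layers thus splice to one with `2n + 2`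
layers. For derived categories the sequence is applied to each term of a complex. For the
Igusa–Todorov distance, `0 → J → R → S → 0` shows that inflated projectives have projective
dimension at most one, so syzygies over `S` become syzygies over `R` after one more step
(`IsSyzygy.succ_map`), and the horseshoe lemma joins two resolutions of length `m` into one of
length `2m + 1` (`HasExactResolution.of_isExtension`). -/

noncomputable section

universe u v w

open scoped ZeroObject

/-! ### Short exact sequences, the horseshoe lemma and filtrations -/

section Extensions

variable {C : Type u} [Category.{v} C] [Abelian C]

/-- `Y` is an extension of `Z` by `X`: there is a short exact sequence `0 ⟶ X ⟶ Y ⟶ Z ⟶ 0`. -/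
def IsExtension (X Y Z : C) : Prop :=
  ∃ (f : X ⟶ Y) (g : Y ⟶ Z) (w : f ≫ g = 0), (ShortComplex.mk f g w).ShortExact

lemma CategoryTheory.ShortComplex.ShortExact.isExtension {S : ShortComplex C}
    (hS : S.ShortExact) : IsExtension S.X₁ S.X₂ S.X₃ :=
  ⟨S.f, S.g, S.zero, hS⟩

namespace IsExtension

lemma of_iso {X Y Z X' Y' Z' : C} (h : IsExtension X Y Z) (e₁ : X ≅ X') (e₂ : Y ≅ Y')
    (e₃ : Z ≅ Z') : IsExtension X' Y' Z' := by
  obtain ⟨f, g, w, h⟩ := h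
  refine ⟨e₁.inv ≫ f ≫ e₂.hom, e₂.inv ≫ g ≫ e₃.hom, by simp [reassoc_of% w], ?_⟩
  exact ShortComplex.shortExact_of_iso
    (ShortComplex.isoMk e₁ e₂ e₃ (by simp) (by simp)) h

lemma of_mono {X Y : C} (f : X ⟶ Y) [Mono f] : IsExtension X Y (cokernel f) :=
  ⟨f, cokernel.π f, cokernel.condition f,
    { exact := ShortComplex.exact_of_g_is_cokernel _ (cokernelIsCokernel f) }⟩

lemma of_epi {Y Z : C} (g : Y ⟶ Z) [Epi g] : IsExtension (kernel g) Y Z :=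
  ⟨kernel.ι g, g, kernel.condition g,
    { exact := ShortComplex.exact_of_f_is_kernel _ (kernelIsKernel g) }⟩

lemma of_iso_of_isZero {X Y Z : C} (e : X ≅ Y) (hZ : IsZero Z) : IsExtension X Y Z :=
  (of_mono e.hom).of_iso (Iso.refl _) (Iso.refl _)
    ((isZero_cokernel_of_epi e.hom).iso hZ)

lemma of_isZero_of_iso {X Y Z : C} (hX : IsZero X) (e : Y ≅ Z) : IsExtension X Y Z :=
  (of_epi e.hom).of_iso ((isZero_kernel_of_mono e.hom).iso hX) (Iso.refl _) (Iso.refl _)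

/-- The kernels of a morphism of short exact sequences form a short exact sequence if the first
component is an epimorphism. -/
lemma kernels {S T : ShortComplex C} (hS : S.ShortExact) (hT : T.ShortExact) (φ : S ⟶ T)
    [Epi φ.τ₁] : IsExtension (kernel φ.τ₁) (kernel φ.τ₂) (kernel φ.τ₃) := by
  have := hS.mono_f
  have := hS.epi_g
  have := hT.mono_f
  let f : kernel φ.τ₁ ⟶ kernel φ.τ₂ := kernel.map _ _ S.f T.f φ.comm₁₂
  let g : kernel φ.τ₂ ⟶ kernel φ.τ₃ := kernel.map _ _ S.g T.g φ.comm₂₃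
  have hf : f ≫ kernel.ι φ.τ₂ = kernel.ι φ.τ₁ ≫ S.f := by simp [f]
  have hg : g ≫ kernel.ι φ.τ₃ = kernel.ι φ.τ₂ ≫ S.g := by simp [g]
  have w : f ≫ g = 0 := by
    rw [← cancel_mono (kernel.ι φ.τ₃)]
    simp [hg, reassoc_of% hf]
  have hfm : Mono f := by
    have : Mono (f ≫ kernel.ι φ.τ₂) := by rw [hf]; infer_instance
    exact mono_of_mono f (kernel.ι φ.τ₂)
  refine ⟨f, g, w, ?_⟩
  have hexact : (ShortComplex.mk f g w).Exact := by
    rw [ShortComplex.exact_iff_exact_up_to_refinements]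
    intro A x hx
    dsimp at x hx
    have h1 : (x ≫ kernel.ι φ.τ₂) ≫ S.g = 0 := by
      rw [Category.assoc, ← hg, reassoc_of% hx, zero_comp]
    have h2 : hS.exact.lift _ h1 ≫ S.f = x ≫ kernel.ι φ.τ₂ := hS.exact.lift_f _ _
    have h3 : hS.exact.lift _ h1 ≫ φ.τ₁ = 0 := by
      rw [← cancel_mono T.f, Category.assoc, φ.comm₁₂, reassoc_of% h2]
      simp
    refine ⟨A, 𝟙 A, inferInstance, kernel.lift _ _ h3, ?_⟩
    dsimp
    rw [← cancel_mono (kernel.ι φ.τ₂), Category.id_comp, Category.assoc, hf,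
      kernel.lift_ι_assoc, h2]
  have hepi : Epi g := by
    rw [epi_iff_surjective_up_to_refinements]
    intro A z
    obtain ⟨A', π, _, y, hy⟩ := surjective_up_to_refinements_of_epi S.g (z ≫ kernel.ι φ.τ₃)
    have h1 : (y ≫ φ.τ₂) ≫ T.g = 0 := by
      rw [Category.assoc, φ.comm₂₃, ← reassoc_of% hy]
      simp
    have h2 : hT.exact.lift _ h1 ≫ T.f = y ≫ φ.τ₂ := hT.exact.lift_f _ _
    obtain ⟨A'', π', _, x, hx⟩ := surjective_up_to_refinements_of_epi φ.τ₁ (hT.exact.lift _ h1)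
    have h3 : (π' ≫ y - x ≫ S.f) ≫ φ.τ₂ = 0 := by
      rw [Preadditive.sub_comp, Category.assoc, Category.assoc, ← φ.comm₁₂, ← reassoc_of% hx, h2,
        sub_self]
    refine ⟨A'', π' ≫ π, epi_comp _ _, kernel.lift _ _ h3, ?_⟩
    rw [← cancel_mono (kernel.ι φ.τ₃)]
    simp only [Category.assoc, hg, kernel.lift_ι_assoc, Preadditive.sub_comp, S.zero, comp_zero,
      sub_zero, hy]
  exact { exact := hexact }

lemma iso_kernel {S : ShortComplex C} (hS : S.ShortExact) : Nonempty (kernel S.g ≅ S.X₁) :=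
  ⟨(kernelIsKernel S.g).conePointUniqueUpToIso hS.fIsKernel⟩

/-- The horseshoe lemma. -/
lemma horseshoe {X Y Z X₁ U Z₁ P : C} (h : IsExtension X Y Z) (hX : IsExtension X₁ U X)
    (hZ : IsExtension Z₁ P Z) [Projective P] :
    ∃ Y₁, IsExtension X₁ Y₁ Z₁ ∧ IsExtension Y₁ (U ⊞ P) Y := by
  obtain ⟨f, g, w, h⟩ := h
  obtain ⟨i, p, wp, hX⟩ := hX
  obtain ⟨j, q, wq, hZ⟩ := hZ
  have : Epi g := h.epi_g
  have : Epi p := hX.epi_g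
  have : Epi q := hZ.epi_g
  have : Mono f := h.mono_f
  have : Mono (ShortComplex.mk f g w).f := h.mono_f
  let q' : P ⟶ Y := Projective.factorThru q g
  have hq' : q' ≫ g = q := Projective.factorThru_comp q g
  let S := ShortComplex.mk (biprod.inl : U ⟶ U ⊞ P) (biprod.snd : U ⊞ P ⟶ P) (by simp)
  have hS : S.ShortExact := (ShortComplex.Splitting.mk (S := S)
      biprod.fst biprod.inr (by simp [S]) (by simp [S]) (by simp [S])).shortExact
  -- The split sequence on `U` and `P` is mapped to the given one by means of a lift `q'` of `q`
  -- through `g`; the kernels of this morphism form the required sequence.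
  let φ : S ⟶ ShortComplex.mk f g w :=
    { τ₁ := p
      τ₂ := biprod.desc (p ≫ f) q'
      τ₃ := q
      comm₁₂ := by simp [S]
      comm₂₃ := by
        dsimp [S]
        ext <;> simp [w, hq'] }
  have h1 : Epi φ.τ₁ := ‹Epi p›
  have h3 : Epi φ.τ₃ := ‹Epi q›
  have h2 : Epi φ.τ₂ := by
    have := hS.epi_g
    rw [epi_iff_surjective_up_to_refinements]
    intro A y
    obtain ⟨A', π, _, z, hz⟩ := surjective_up_to_refinements_of_epi q (y ≫ g)
    have h1 : (π ≫ y - z ≫ q') ≫ g = 0 := by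
      rw [Preadditive.sub_comp, Category.assoc, Category.assoc, hq', hz, sub_self]
    obtain ⟨A'', π', _, x, hx⟩ := surjective_up_to_refinements_of_epi p (h.exact.lift _ h1)
    refine ⟨A'', π' ≫ π, epi_comp _ _, biprod.lift x (π' ≫ z), ?_⟩
    have h2 : h.exact.lift _ h1 ≫ f = π ≫ y - z ≫ q' := h.exact.lift_f _ _
    dsimp [φ]
    rw [biprod.lift_desc, ← reassoc_of% hx, h2, Preadditive.comp_sub]
    simp
  obtain ⟨e₁⟩ := iso_kernel hX
  obtain ⟨e₃⟩ := iso_kernel hZ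
  exact ⟨kernel φ.τ₂, (kernels hS h φ).of_iso e₁ (Iso.refl _) e₃, of_epi φ.τ₂⟩

/-- The kernel of a composition of two epimorphisms is an extension of their kernels. -/
lemma comp_epi {Q P L M N : C} (h₁ : IsExtension Q P M) (h₂ : IsExtension L M N) :
    ∃ N₁, IsExtension Q N₁ L ∧ IsExtension N₁ P N := by
  obtain ⟨i, p, w, h₁⟩ := h₁
  obtain ⟨f, g, w', h₂⟩ := h₂
  have : Epi p := h₁.epi_g
  have : Epi g := h₂.epi_g
  let T := ShortComplex.mk (0 : 0 ⟶ N) (𝟙 N) (by simp)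
  have hT : T.ShortExact := {
    exact := (T.exact_iff_mono rfl).2 (by dsimp [T]; infer_instance)
    mono_f := ⟨fun _ _ _ => (isZero_zero C).eq_of_tgt _ _⟩
    epi_g := by dsimp [T]; infer_instance }
  let φ : ShortComplex.mk i p w ⟶ T :=
    { τ₁ := 0
      τ₂ := p ≫ g
      τ₃ := g
      comm₁₂ := by simp [T, reassoc_of% w]
      comm₂₃ := by simp [T] }
  have : Epi φ.τ₁ := ⟨fun _ _ _ => (isZero_zero C).eq_of_src _ _⟩
  have h := kernels h₁ hT φ
  obtain ⟨e⟩ := iso_kernel h₂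
  exact ⟨kernel φ.τ₂, h.of_iso (kernelZeroIsoSource) (Iso.refl _) e, by
    have : Epi φ.τ₂ := epi_comp p g
    exact of_epi φ.τ₂⟩

/-- The quotients of a filtration `U ⊆ X ⊆ A`. -/
lemma comp_mono {U X L A Y : C} (h₁ : IsExtension U X L) (h₂ : IsExtension X A Y) :
    ∃ A₁, IsExtension U A A₁ ∧ IsExtension L A₁ Y := by
  obtain ⟨i, p, w, h₁⟩ := h₁
  obtain ⟨f, g, w', h₂⟩ := h₂
  have : Mono i := h₁.mono_f
  have : Mono f := h₂.mono_f
  have : Epi p := h₁.epi_g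
  have : Epi g := h₂.epi_g
  let c := cokernel.π (i ≫ f)
  have hc : (ShortComplex.mk (i ≫ f) c (cokernel.condition _)).ShortExact :=
    { exact := ShortComplex.exact_of_g_is_cokernel _ (cokernelIsCokernel _) }
  let g' : cokernel (i ≫ f) ⟶ Y := cokernel.desc _ g (by simp [w'])
  have hg' : c ≫ g' = g := by simp [c, g']
  have : Epi g' := by
    have : Epi (c ≫ g') := by rw [hg']; infer_instance
    exact epi_of_epi c g'
  have hc' : IsExtension U A (cokernel (i ≫ f)) := hc.isExtension
  refine ⟨cokernel (i ≫ f), hc', ?_⟩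
  let l : L ⟶ cokernel (i ≫ f) := h₁.exact.desc (f ≫ c) (by
    rw [← Category.assoc]
    exact cokernel.condition _)
  have hl : p ≫ l = f ≫ c := h₁.exact.g_desc _ _
  have wl : l ≫ g' = 0 := by
    rw [← cancel_epi p, reassoc_of% hl, hg', w', comp_zero]
  refine ⟨l, g', wl, ?_⟩
  have hm : Mono l := by
    rw [Preadditive.mono_iff_cancel_zero]
    intro A' x hx
    obtain ⟨A'', π, _, y, hy⟩ := surjective_up_to_refinements_of_epi p x
    have h3 : (y ≫ f) ≫ c = 0 := by
      rw [Category.assoc, ← hl, ← reassoc_of% hy, hx, comp_zero]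
    have h4 : hc.exact.lift _ h3 ≫ i ≫ f = y ≫ f := by
      have := hc.mono_f
      exact hc.exact.lift_f _ _
    have h5 : hc.exact.lift _ h3 ≫ i = y := by
      rw [← cancel_mono f, Category.assoc, h4]
    rw [← cancel_epi π, hy, ← h5, Category.assoc, w, comp_zero, comp_zero]
  have he : (ShortComplex.mk l g' wl).Exact := by
    rw [ShortComplex.exact_iff_exact_up_to_refinements]
    intro A' x hx
    dsimp at x hx
    obtain ⟨A'', π, _, y, hy⟩ := surjective_up_to_refinements_of_epi c x
    have h3 : y ≫ g = 0 := by
      rw [← hg', ← reassoc_of% hy, hx, comp_zero]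
    have h4 : h₂.exact.lift _ h3 ≫ f = y := h₂.exact.lift_f _ _
    refine ⟨A'', π, inferInstance, h₂.exact.lift _ h3 ≫ p, ?_⟩
    dsimp
    rw [hy, Category.assoc, hl, reassoc_of% h4]
  exact { exact := he }

/-- The direct sum of two short exact sequences. -/
lemma directSum {X Y Z X' Y' Z' : C} (h : IsExtension X Y Z) (h' : IsExtension X' Y' Z') :
    IsExtension (X ⊞ X') (Y ⊞ Y') (Z ⊞ Z') := by
  obtain ⟨f, g, w, h⟩ := h
  obtain ⟨f', g', w', h'⟩ := h'
  have := h.mono_f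
  have := h'.mono_f
  have := h.epi_g
  have := h'.epi_g
  refine ⟨biprod.map f f', biprod.map g g', by ext <;> simp [w, w'], ?_⟩
  have : (ShortComplex.mk (biprod.map f f') (biprod.map g g')
      (by ext <;> simp [w, w'])).Exact := by
    rw [ShortComplex.exact_iff_exact_up_to_refinements]
    intro A x hx
    dsimp at x hx
    have h1 : (x ≫ biprod.fst) ≫ g = 0 := by
      have := hx =≫ biprod.fst
      simpa using this
    have h2 : (x ≫ biprod.snd) ≫ g' = 0 := by
      have := hx =≫ biprod.snd
      simpa using this
    refine ⟨A, 𝟙 A, inferInstance, biprod.lift (h.exact.lift _ h1) (h'.exact.lift _ h2), ?_⟩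
    have h3 : h.exact.lift _ h1 ≫ f = _ := h.exact.lift_f _ _
    have h4 : h'.exact.lift _ h2 ≫ f' = _ := h'.exact.lift_f _ _
    dsimp
    ext <;> simp [h3, h4]
  exact { exact := this }

/-- An extension by a retract `X` of `E` is a retract of an extension by `E`. -/
lemma of_retract {X A Y E : C} (h : IsExtension X A Y) (r : Retract X E) :
    ∃ A', IsExtension E A' Y ∧ Nonempty (Retract A A') := by
  have h1 : IsExtension (X ⊞ kernel r.r) (A ⊞ kernel r.r) (Y ⊞ 0) :=
    h.directSum (of_iso_of_isZero (Iso.refl _) (isZero_zero C))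
  -- A retract splits off: `E` is the sum of `X` and the kernel of the retraction. Adding this
  -- kernel to the first two terms turns `X` into `E` and leaves `Y` unchanged.
  have e : X ⊞ kernel r.r ≅ E :=
    { hom := biprod.desc r.i (kernel.ι r.r)
      inv := biprod.lift r.r (kernel.lift _ (𝟙 E - r.r ≫ r.i) (by simp))
      hom_inv_id := by
        ext <;> simp
      inv_hom_id := by simp [biprod.lift_desc] }
  exact ⟨A ⊞ kernel r.r, h1.of_iso e (Iso.refl _) (isoBiprodZero (isZero_zero C)).symm,
    ⟨⟨biprod.inl, biprod.fst, by simp⟩⟩⟩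

lemma map {D : Type*} [Category D] [Abelian D] (F : C ⥤ D) [F.Additive]
    [PreservesFiniteLimits F] [PreservesFiniteColimits F]
    {X Y Z : C} (h : IsExtension X Y Z) : IsExtension (F.obj X) (F.obj Y) (F.obj Z) := by
  obtain ⟨f, g, w, h⟩ := h
  exact (h.map_of_exact F).isExtension

end IsExtension

end Extensions

/-! ### Additive closures and extension layers -/

section AddClosure

attribute [local instance] Abelian.hasFiniteBiproducts

variable {C : Type u} [Category.{v} C] [Abelian C]

/-- The identity of a summand is a finite sum of maps through objects of `U`. In this form the
condition is visibly preserved by additive functors, and lifting arguments can be made summand by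
summand. -/
lemma addClosure_iff (U : ObjectProperty C) (X : C) :
    addClosure U X ↔ ∃ (n : ℕ) (f : Fin n → C) (p : ∀ i, X ⟶ f i) (q : ∀ i, f i ⟶ X),
      (∀ i, U (f i)) ∧ ∑ i, p i ≫ q i = 𝟙 X := by
  constructor
  · rintro ⟨n, f, hf, ⟨r⟩⟩
    refine ⟨n, f, fun i => r.i ≫ biproduct.π f i, fun i => biproduct.ι f i ≫ r.r, hf, ?_⟩
    have h : ∑ i, biproduct.π f i ≫ biproduct.ι f i = 𝟙 _ := biproduct.total
    calc _ = r.i ≫ (∑ i, biproduct.π f i ≫ biproduct.ι f i) ≫ r.r := by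
          simp only [Preadditive.comp_sum, Preadditive.sum_comp, Category.assoc]
      _ = 𝟙 X := by rw [h]; simp
  · rintro ⟨n, f, p, q, hf, h⟩
    exact ⟨n, f, hf, ⟨⟨biproduct.lift p, biproduct.desc q, by rw [biproduct.lift_desc, h]⟩⟩⟩

lemma addClosure_of_fintype {U : ObjectProperty C} {X : C} {ι : Type*} [Fintype ι] (f : ι → C)
    (p : ∀ i, X ⟶ f i) (q : ∀ i, f i ⟶ X) (hf : ∀ i, U (f i)) (h : ∑ i, p i ≫ q i = 𝟙 X) :
    addClosure U X := by
  rw [addClosure_iff]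
  let e := Fintype.equivFin ι
  refine ⟨_, fun i => f (e.symm i), fun i => p (e.symm i), fun i => q (e.symm i),
    fun i => hf _, ?_⟩
  rw [← h]
  exact e.symm.sum_comp fun i => p i ≫ q i

lemma le_addClosure (U : ObjectProperty C) : U ≤ addClosure U := fun X hX =>
  addClosure_of_fintype (ι := Fin 1) (fun _ => X) (fun _ => 𝟙 X) (fun _ => 𝟙 X)
    (fun _ => hX) (by simp)

/-- A class of objects closed under direct summands and finite direct sums. -/
structure IsAddClosed (P : ObjectProperty C) : Prop where
  prop_of_sum {n : ℕ} {X : C} (f : Fin n → C) (p : ∀ i, X ⟶ f i) (q : ∀ i, f i ⟶ X)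
    (hf : ∀ i, P (f i)) (h : ∑ i, p i ≫ q i = 𝟙 X) : P X

namespace IsAddClosed

variable {P : ObjectProperty C} (hP : IsAddClosed P)

include hP

lemma addClosure_le {U : ObjectProperty C} (h : U ≤ P) : addClosure U ≤ P := by
  intro X hX
  obtain ⟨n, f, p, q, hf, h'⟩ := (addClosure_iff U X).1 hX
  exact hP.prop_of_sum f p q (fun i => h _ (hf i)) h'

lemma retract {X Y : C} (r : Retract X Y) (hY : P Y) : P X :=
  hP.prop_of_sum (n := 1) (fun _ => Y) (fun _ => r.i) (fun _ => r.r) (fun _ => hY) (by simp)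

lemma iso {X Y : C} (e : X ≅ Y) (hX : P X) : P Y := hP.retract e.symm.retract hX

lemma biprod {X Y : C} (hX : P X) (hY : P Y) : P (X ⊞ Y) :=
  hP.addClosure_le le_rfl _ (addClosure_of_fintype (ι := Bool) (fun b => cond b X Y)
    (fun b => match b with | true => biprod.fst | false => biprod.snd)
    (fun b => match b with | true => biprod.inl | false => biprod.inr)
    (fun b => by cases b <;> assumption) (by simp))

lemma of_isZero {X : C} (hX : IsZero X) : P X :=
  hP.prop_of_sum (n := 0) Fin.elim0 (fun i => i.elim0) (fun i => i.elim0) (fun i => i.elim0)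
    (hX.eq_of_src _ _)

end IsAddClosed

lemma isAddClosed_addClosure (U : ObjectProperty C) : IsAddClosed (addClosure U) where
  prop_of_sum {n X} f p q hf h := by
    choose m g p' q' hg hs using fun i => (addClosure_iff U _).1 (hf i)
    refine addClosure_of_fintype (ι := Σ i, Fin (m i)) (fun x => g x.1 x.2)
      (fun x => p x.1 ≫ p' x.1 x.2) (fun x => q' x.1 x.2 ≫ q x.1) (fun x => hg _ _) ?_
    rw [Fintype.sum_sigma, ← h]
    refine Finset.sum_congr rfl fun i _ => ?_
    have := hs i
    calc _ = p i ≫ (∑ j, p' i j ≫ q' i j) ≫ q i := by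
          simp [Preadditive.comp_sum, Preadditive.sum_comp]
      _ = _ := by rw [this]; simp

lemma addClosure_singleton_le {P : ObjectProperty C} (hP : IsAddClosed P) {X : C} (hX : P X) :
    addClosure (ObjectProperty.singleton X) ≤ P :=
  hP.addClosure_le (by
    rintro Y hY
    obtain rfl := (ObjectProperty.singleton_iff _ _).1 hY
    exact hX)

lemma addClosure_singleton_self (X : C) : addClosure (ObjectProperty.singleton X) X :=
  le_addClosure _ _ ((ObjectProperty.singleton_iff _ _).2 rfl)

lemma addClosure_map {D : Type*} [Category D] [Abelian D] (F : C ⥤ D) [F.Additive]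
    {U : ObjectProperty C} {U' : ObjectProperty D} (h : ∀ X, U X → U' (F.obj X)) {X : C}
    (hX : addClosure U X) : addClosure U' (F.obj X) := by
  obtain ⟨n, f, p, q, hf, hs⟩ := (addClosure_iff U X).1 hX
  exact addClosure_of_fintype (fun i => F.obj (f i)) (fun i => F.map (p i)) (fun i => F.map (q i))
    (fun i => h _ (hf i)) (by simp only [← F.map_comp, ← F.map_sum, hs, F.map_id])

omit [Abelian C] in
lemma singleton_map {D : Type*} [Category D] (F : C ⥤ D) (T : C) :
    ∀ X, ObjectProperty.singleton T X → ObjectProperty.singleton (F.obj T) (F.obj X) := by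
  intro X hX
  obtain rfl := (ObjectProperty.singleton_iff _ _).1 hX
  exact (ObjectProperty.singleton_iff _ _).2 rfl

/-! ### Extension layers -/

/-- The extensions of objects in `Q` by objects in `P`. -/
def extensionsOf (P Q : ObjectProperty C) : ObjectProperty C := fun A =>
  ∃ S : ShortComplex C, S.ShortExact ∧ S.X₂ = A ∧ P S.X₁ ∧ Q S.X₃

lemma extensionProd_of_isExtension {P Q : ObjectProperty C} {X A Y : C} (h : IsExtension X A Y)
    (hX : P X) (hY : Q Y) : extensionProd P Q A := by
  obtain ⟨f, g, w, h⟩ := h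
  exact le_addClosure (extensionsOf P Q) _ ⟨ShortComplex.mk f g w, h, rfl, hX, hY⟩

lemma isAddClosed_extensionLayer (U : ObjectProperty C) (n : ℕ) :
    IsAddClosed (extensionLayer U (n + 1)) := by
  cases n with
  | zero => exact isAddClosed_addClosure U
  | succ n =>
    exact isAddClosed_addClosure (extensionsOf (addClosure U) (extensionLayer U (n + 1)))

/-- Every object of `extensionProd P Q` is a retract of an extension of an object of `Q` by an
object of `P`. -/
lemma exists_retract_of_extensionProd {P Q : ObjectProperty C} (hP : IsAddClosed P)
    (hQ : IsAddClosed Q) {A : C} (hA : extensionProd P Q A) :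
    ∃ X E Y, IsExtension X E Y ∧ P X ∧ Q Y ∧ Nonempty (Retract A E) := by
  obtain ⟨n, f, hf, ⟨r⟩⟩ := hA
  suffices h : ∃ X E Y, IsExtension X E Y ∧ P X ∧ Q Y ∧ Nonempty (Retract (⨁ f) E) by
    obtain ⟨X, E, Y, h, hX, hY, ⟨r'⟩⟩ := h
    exact ⟨X, E, Y, h, hX, hY, ⟨r.trans r'⟩⟩
  clear r A
  induction n with
  | zero =>
    have hz : IsZero (⨁ f) := by
      rw [IsZero.iff_id_eq_zero]
      ext i
      exact i.elim0
    exact ⟨_, _, _, IsExtension.of_iso_of_isZero (Iso.refl (⨁ f)) hz, hP.of_isZero hz,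
      hQ.of_isZero hz, ⟨Retract.refl _⟩⟩
  | succ n ih =>
    obtain ⟨X, E, Y, h, hX, hY, ⟨r⟩⟩ := ih (fun i => f i.succ) fun i => hf i.succ
    obtain ⟨S, hS, hS₂, h₁, h₃⟩ := hf 0
    refine ⟨_, _, _, hS.isExtension.directSum h, hP.biprod h₁ hX, hQ.biprod h₃ hY,
      ⟨⟨biprod.lift (biproduct.π f 0 ≫ eqToHom hS₂.symm)
          (biproduct.lift (fun i : Fin n => biproduct.π f i.succ) ≫ r.i),
        biprod.desc (eqToHom hS₂ ≫ biproduct.ι f 0)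
          (r.r ≫ biproduct.desc fun i : Fin n => biproduct.ι f i.succ), ?_⟩⟩⟩
    rw [biprod.lift_desc]
    simp only [Category.assoc, eqToHom_trans_assoc, eqToHom_refl, Category.id_comp,
      r.retract_assoc, biproduct.lift_desc]
    rw [← biproduct.total, Fin.sum_univ_succ]

/-- An object is in the class `[U]_{n + m + 2}` if it is an extension of an object of
`[U]_{m + 1}` by an object of `[U]_{n + 1}`. -/
lemma extensionLayer_of_isExtension (U : ObjectProperty C) (n m : ℕ) {X A Y : C}
    (h : IsExtension X A Y) (hX : extensionLayer U (n + 1) X)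
    (hY : extensionLayer U (m + 1) Y) : extensionLayer U (n + m + 2) A := by
  induction n generalizing X A Y with
  | zero =>
    rw [zero_add]
    exact extensionProd_of_isExtension h hX hY
  | succ n ih =>
    obtain ⟨X', E, L, hE, hX', hL, ⟨r⟩⟩ :=
      exists_retract_of_extensionProd (isAddClosed_addClosure U) (isAddClosed_extensionLayer U n) hX
    obtain ⟨A', hA', ⟨r'⟩⟩ := h.of_retract r
    -- Reassociate the filtration `X' ⊆ E ⊆ A'`: the quotient `A₁` of `A'` by `X'` is an extension
    -- of `Y` by `L`, to which the induction hypothesis applies, and `X'` is in `add U`.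
    obtain ⟨A₁, h₁, h₂⟩ := IsExtension.comp_mono hE hA'
    have h3 := ih h₂ hL hY
    have h4 : extensionLayer U (n + m + 3) A' := extensionProd_of_isExtension h₁ hX' h3
    have h5 : extensionLayer U (n + m + 3) A :=
      (isAddClosed_extensionLayer U (n + m + 2)).retract r' h4
    rwa [show n + 1 + m + 2 = n + m + 3 by lia]

lemma extensionLayer_map {D : Type*} [Category D] [Abelian D] (F : C ⥤ D) [F.Additive]
    [PreservesFiniteLimits F] [PreservesFiniteColimits F]
    {U : ObjectProperty C} {U' : ObjectProperty D} (h : ∀ X, U X → U' (F.obj X)) (n : ℕ) {X : C}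
    (hX : extensionLayer U (n + 1) X) : extensionLayer U' (n + 1) (F.obj X) := by
  induction n generalizing X with
  | zero => exact addClosure_map F h hX
  | succ n ih =>
    refine addClosure_map (U := extensionsOf (addClosure U) (extensionLayer U (n + 1)))
      (U' := extensionsOf (addClosure U') (extensionLayer U' (n + 1))) F ?_ hX
    rintro _ ⟨S, hS, rfl, h₁, h₃⟩
    exact ⟨S.map F, hS.map_of_exact F, rfl, addClosure_map F h h₁, ih h₃⟩

end AddClosure

/-! ### Syzygies and exact resolutions -/

section Syzygies

attribute [local instance] Abelian.hasFiniteBiproducts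

variable {C : Type u} [Category.{v} C] [Abelian C]

lemma isSyzygy_succ_iff (X : C) (n : ℕ) (K : C) :
    IsSyzygy X (n + 1) K ↔ ∃ P Y, IsExtension K P Y ∧ Projective P ∧ IsSyzygy X n Y := by
  constructor
  · rintro ⟨S, hS, ⟨e⟩, hP, h⟩
    exact ⟨_, _, hS.isExtension.of_iso e (Iso.refl _) (Iso.refl _), hP, h⟩
  · rintro ⟨P, Y, ⟨f, g, w, h⟩, hP, hY⟩
    exact ⟨_, h, ⟨Iso.refl _⟩, hP, hY⟩

lemma IsSyzygy.of_iso {X K K' : C} {n : ℕ} (h : IsSyzygy X n K) (e : K ≅ K') :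
    IsSyzygy X n K' := by
  cases n with
  | zero => exact ⟨e.symm ≪≫ h.some⟩
  | succ n =>
    obtain ⟨S, hS, ⟨e'⟩, hP, h⟩ := h
    exact ⟨S, hS, ⟨e' ≪≫ e⟩, hP, h⟩

lemma IsSyzygy.trans {X K L : C} {n m : ℕ} (h : IsSyzygy X n K) (h' : IsSyzygy K m L) :
    IsSyzygy X (n + m) L := by
  induction m generalizing L with
  | zero => exact h.of_iso h'.some.symm
  | succ m ih =>
    obtain ⟨S, hS, e, hP, h'⟩ := h'
    exact ⟨S, hS, e, hP, ih h'⟩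

lemma isSyzygy_one_iff (X K : C) :
    IsSyzygy X 1 K ↔ ∃ P, IsExtension K P X ∧ Projective P := by
  rw [isSyzygy_succ_iff]
  constructor
  · rintro ⟨P, Y, h, hP, ⟨e⟩⟩
    exact ⟨P, h.of_iso (Iso.refl _) (Iso.refl _) e, hP⟩
  · rintro ⟨P, h, hP⟩
    exact ⟨P, X, h, hP, ⟨Iso.refl _⟩⟩

lemma IsSyzygy.exists_one_of_succ {X K : C} {n : ℕ} (h : IsSyzygy X (n + 1) K) :
    ∃ K₁, IsSyzygy X n K₁ ∧ IsSyzygy K₁ 1 K := by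
  obtain ⟨P, Y, h, hP, hY⟩ := (isSyzygy_succ_iff _ _ _).1 h
  exact ⟨Y, hY, (isSyzygy_one_iff _ _).2 ⟨P, h, hP⟩⟩

lemma exists_isSyzygy_one [EnoughProjectives C] (X : C) : ∃ K, IsSyzygy X 1 K :=
  ⟨_, (isSyzygy_one_iff _ _).2
    ⟨_, IsExtension.of_epi (Projective.π X), inferInstance⟩⟩

lemma IsSyzygy.map {D : Type*} [Category D] [Abelian D] (F : C ⥤ D) [F.Additive]
    [PreservesFiniteLimits F] [PreservesFiniteColimits F]
    (hF : ∀ P, Projective P → Projective (F.obj P)) {X K : C} {n : ℕ} (h : IsSyzygy X n K) :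
    IsSyzygy (F.obj X) n (F.obj K) := by
  induction n generalizing K with
  | zero => exact ⟨F.mapIso h.some⟩
  | succ n ih =>
    obtain ⟨P, Y, h, hP, hY⟩ := (isSyzygy_succ_iff _ _ _).1 h
    exact (isSyzygy_succ_iff _ _ _).2 ⟨_, _, h.map F, hF _ hP, ih hY⟩

lemma IsSyzygy.of_iso_left {X X' K : C} {n : ℕ} (h : IsSyzygy X n K) (e : X ≅ X') :
    IsSyzygy X' n K := by
  have h0 : IsSyzygy X' 0 X := ⟨e⟩
  simpa using h0.trans h

/-- The horseshoe lemma for syzygies. -/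
lemma IsSyzygy.horseshoe {X Y Z K M : C} {n : ℕ} (h : IsExtension X Y Z) (hX : IsSyzygy X n K)
    (hZ : IsSyzygy Z n M) : ∃ L, IsExtension K L M ∧ IsSyzygy Y n L := by
  induction n generalizing K M with
  | zero => exact ⟨Y, h.of_iso hX.some.symm (Iso.refl _) hZ.some.symm, ⟨Iso.refl _⟩⟩
  | succ n ih =>
    obtain ⟨P, X', hX', hP, hX⟩ := (isSyzygy_succ_iff _ _ _).1 hX
    obtain ⟨P', Z', hZ', hP', hZ⟩ := (isSyzygy_succ_iff _ _ _).1 hZ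
    obtain ⟨L', h', hY⟩ := ih hX hZ
    obtain ⟨L, hL, hL'⟩ := h'.horseshoe hX' hZ'
    exact ⟨L, hL, (isSyzygy_succ_iff _ _ _).2 ⟨_, _, hL', inferInstance, hY⟩⟩

/-- If the projective dimension of `M` is at most one, the first syzygies of a subobject of `M`
are second syzygies of the quotient. -/
lemma IsSyzygy.two_of_isExtension {L M N Q W : C} (h : IsExtension L M N) (hM : IsSyzygy M 1 Q)
    [Projective Q] (hL : IsSyzygy L 1 W) : IsSyzygy N 2 W := by
  obtain ⟨P, hP, _⟩ := (isSyzygy_one_iff _ _).1 hM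
  obtain ⟨P', hP', _⟩ := (isSyzygy_one_iff _ _).1 hL
  obtain ⟨N₁, h₁, h₂⟩ := hP.comp_epi h
  -- `N₁` is the kernel of `P ⟶ N` and an extension of `L` by `Q`. The projective `Q` is covered by
  -- itself with kernel zero, so the horseshoe lemma yields a syzygy of `N₁` isomorphic to `W`.
  obtain ⟨W', h₃, h₄⟩ :=
    h₁.horseshoe (IsExtension.of_isZero_of_iso (isZero_zero C) (Iso.refl Q)) hP'
  obtain ⟨f, g, w, h₃⟩ := h₃
  have : IsIso g := h₃.isIso_g_iff.2 (isZero_zero C)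
  have hN : IsSyzygy N 1 N₁ := (isSyzygy_one_iff _ _).2 ⟨P, h₂, inferInstance⟩
  have hN₁ : IsSyzygy N₁ 1 W' := (isSyzygy_one_iff _ _).2 ⟨_, h₄, inferInstance⟩
  exact (hN.trans hN₁).of_iso (asIso g)

/-- If an exact functor maps projective objects to objects of projective dimension at most one,
then a first syzygy of the image of an `n`-th syzygy of `B` is an `(n + 1)`-st syzygy of the image
of `B`. -/
lemma IsSyzygy.succ_map {D : Type*} [Category D] [Abelian D] (F : D ⥤ C) [F.Additive]
    [PreservesFiniteLimits F] [PreservesFiniteColimits F]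
    (hF : ∀ P, Projective P → ∃ Q, Projective Q ∧ IsSyzygy (F.obj P) 1 Q) {B L : D} {n : ℕ}
    (h : IsSyzygy B n L) {W : C} (hW : IsSyzygy (F.obj L) 1 W) :
    IsSyzygy (F.obj B) (n + 1) W := by
  induction n generalizing L W with
  | zero => simpa using hW.of_iso_left (F.mapIso h.some)
  | succ n ih =>
    obtain ⟨P, L', hL', hP, hB⟩ := (isSyzygy_succ_iff _ _ _).1 h
    obtain ⟨Q, _, hQ⟩ := hF P hP
    obtain ⟨W', h₁, h₂⟩ := (IsSyzygy.two_of_isExtension (hL'.map F) hQ hW).exists_one_of_succ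
    exact (ih hB h₁).trans h₂

/-! ### Resolutions -/

lemma hasExactResolution_succ_iff (U : ObjectProperty C) (m : ℕ) (X : C) :
    HasExactResolution U (m + 1) X ↔
      ∃ X₁ U₀, IsExtension X₁ U₀ X ∧ U U₀ ∧ HasExactResolution U m X₁ := by
  constructor
  · rintro ⟨S, hS, ⟨e⟩, hU, h⟩
    exact ⟨_, _, hS.isExtension.of_iso (Iso.refl _) (Iso.refl _) e, hU, h⟩
  · rintro ⟨X₁, U₀, ⟨f, g, w, h⟩, hU, hX⟩
    exact ⟨_, h, ⟨Iso.refl _⟩, hU, hX⟩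

lemma HasExactResolution.of_iso {U : ObjectProperty C} (hU : IsAddClosed U) {m : ℕ} {X X' : C}
    (h : HasExactResolution U m X) (e : X ≅ X') : HasExactResolution U m X' := by
  cases m with
  | zero => exact hU.iso e h
  | succ m =>
    obtain ⟨S, hS, ⟨e'⟩, h, h'⟩ := h
    exact ⟨S, hS, ⟨e' ≪≫ e⟩, h, h'⟩

lemma HasExactResolution.mono {U U' : ObjectProperty C} (h : U ≤ U') {m : ℕ} {X : C}
    (hX : HasExactResolution U m X) : HasExactResolution U' m X := by
  induction m generalizing X with
  | zero => exact h _ hX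
  | succ m ih =>
    obtain ⟨S, hS, e, hU, hX⟩ := hX
    exact ⟨S, hS, e, h _ hU, ih hX⟩

lemma HasExactResolution.map {D : Type*} [Category D] [Abelian D] (F : C ⥤ D) [F.Additive]
    [PreservesFiniteLimits F] [PreservesFiniteColimits F]
    {U : ObjectProperty C} {U' : ObjectProperty D} (h : ∀ X, U X → U' (F.obj X)) {m : ℕ} {X : C}
    (hX : HasExactResolution U m X) : HasExactResolution U' m (F.obj X) := by
  induction m generalizing X with
  | zero => exact h _ hX
  | succ m ih =>
    obtain ⟨S, hS, ⟨e⟩, hU, hX⟩ := hX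
    exact ⟨S.map F, hS.map_of_exact F, ⟨F.mapIso e⟩, h _ hU, ih hX⟩

/-- The first syzygies of the objects of `add U` are in every class closed under direct sums and
summands which contains the projective objects and a first syzygy of each object of `U`. -/
lemma IsSyzygy.prop_of_addClosure {U A : ObjectProperty C} (hA : IsAddClosed A)
    (hproj : ∀ P, Projective P → A P) (hU : ∀ X, U X → ∃ K, IsSyzygy X 1 K ∧ A K) {X W : C}
    (hX : addClosure U X) (hW : IsSyzygy X 1 W) : A W := by
  obtain ⟨n, f, p, q, hf, hs⟩ := (addClosure_iff U X).1 hX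
  obtain ⟨P, ⟨i, π, w, h⟩, _⟩ := (isSyzygy_one_iff _ _).1 hW
  have hU' : ∀ j, ∃ K P, IsExtension K P (f j) ∧ Projective P ∧ A K := fun j => by
    obtain ⟨K, hK, hK'⟩ := hU _ (hf j)
    obtain ⟨P, hP, hP'⟩ := (isSyzygy_one_iff _ _).1 hK
    exact ⟨K, P, hP, hP', hK'⟩
  choose K P' hK hP' hAK using hU'
  choose i' π' w' h' using hK
  have : Epi π := h.epi_g
  have : Mono i := h.mono_f
  have : Mono (ShortComplex.mk i π w).f := h.mono_f
  have hπ' : ∀ j, Epi (π' j) := fun j => (h' j).epi_g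
  have hi' : ∀ j, Mono (i' j) := fun j => (h' j).mono_f
  have hi'' : ∀ j, Mono (ShortComplex.mk (i' j) (π' j) (w' j)).f := fun j => (h' j).mono_f
  let φ : ∀ j, P ⟶ P' j := fun j => Projective.factorThru (π ≫ p j) (π' j)
  let ψ : ∀ j, P' j ⟶ P := fun j => Projective.factorThru (π' j ≫ q j) π
  have hφ : ∀ j, φ j ≫ π' j = π ≫ p j := fun j => Projective.factorThru_comp _ _
  have hψ : ∀ j, ψ j ≫ π = π' j ≫ q j := fun j => Projective.factorThru_comp _ _
  have h1 : ∀ j, (i ≫ φ j) ≫ π' j = 0 := fun j => by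
    rw [Category.assoc, hφ, reassoc_of% w, zero_comp]
  have h2 : ∀ j, (i' j ≫ ψ j) ≫ π = 0 := fun j => by
    rw [Category.assoc, hψ, reassoc_of% (w' j), zero_comp]
  -- The lifted sum need not be the identity of `P`, but the defect factors through `W`. Hence `W`
  -- is a summand of `P` plus the `K j`; the term `P` is there because syzygies are not assumed
  -- minimal.
  have h3 : (𝟙 P - ∑ j, φ j ≫ ψ j) ≫ π = 0 := by
    have : ∀ j, φ j ≫ ψ j ≫ π = π ≫ p j ≫ q j := fun j => by
      rw [hψ, reassoc_of% (hφ j)]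
    simp only [Preadditive.sub_comp, Preadditive.sum_comp, Category.assoc, this,
      ← Preadditive.comp_sum, hs, Category.id_comp, Category.comp_id, sub_self]
  let a : ∀ j, W ⟶ K j := fun j => (h' j).exact.lift _ (h1 j)
  let b : ∀ j, K j ⟶ W := fun j => h.exact.lift _ (h2 j)
  let c : P ⟶ W := h.exact.lift _ h3
  have ha : ∀ j, a j ≫ i' j = i ≫ φ j := fun j => (h' j).exact.lift_f _ _
  have hb : ∀ j, b j ≫ i = i' j ≫ ψ j := fun j => h.exact.lift_f _ _
  have hc : c ≫ i = 𝟙 P - ∑ j, φ j ≫ ψ j := h.exact.lift_f _ _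
  have key : i ≫ c + ∑ j, a j ≫ b j = 𝟙 W := by
    rw [← cancel_mono i]
    simp only [Preadditive.add_comp, Preadditive.sum_comp, Category.assoc, hc, hb,
      Preadditive.comp_sub, Preadditive.comp_sum, Category.comp_id, Category.id_comp,
      reassoc_of% ha, sub_add_cancel]
  refine hA.addClosure_le le_rfl _ (addClosure_of_fintype (ι := Option (Fin n))
    (fun j => j.elim P K) (fun j => match j with | none => i | some j => a j)
    (fun j => match j with | none => c | some j => b j) ?_ ?_)
  · rintro (_ | j)
    · exact hproj P inferInstance
    · exact hAK j
  · rw [Fintype.sum_option]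
    exact key

/-- The horseshoe lemma applied to each short exact piece replaces every term by one of its
syzygies, so the length is unchanged. `W` may be any first syzygy of `X`. -/
lemma HasExactResolution.of_isSyzygy_one [EnoughProjectives C] {U A : ObjectProperty C}
    (hA : IsAddClosed A) (hproj : ∀ P, Projective P → A P)
    (hU : ∀ X, U X → ∃ K, IsSyzygy X 1 K ∧ A K) {m : ℕ} {X W : C}
    (hX : HasExactResolution (addClosure U) m X) (hW : IsSyzygy X 1 W) :
    HasExactResolution A m W := by
  induction m generalizing X W with
  | zero => exact IsSyzygy.prop_of_addClosure hA hproj hU hX hW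
  | succ m ih =>
    obtain ⟨X₁, U₀, h, hU₀, hX₁⟩ := (hasExactResolution_succ_iff _ _ _).1 hX
    obtain ⟨K, hK⟩ := exists_isSyzygy_one X₁
    obtain ⟨W₀, h', hW₀⟩ := IsSyzygy.horseshoe h hK hW
    exact (hasExactResolution_succ_iff _ _ _).2
      ⟨K, W₀, h', IsSyzygy.prop_of_addClosure hA hproj hU hU₀ hW₀, ih hX₁ hK⟩

lemma isAddClosed_projective : IsAddClosed fun P : C => Projective P where
  prop_of_sum f p q hf h := by
    have : ∀ i, Projective (f i) := hf
    refine ⟨fun g e _ => ⟨∑ i, p i ≫ Projective.factorThru (q i ≫ g) e, ?_⟩⟩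
    simp only [Preadditive.sum_comp, Category.assoc, Projective.factorThru_comp]
    simp only [← Category.assoc, ← Preadditive.sum_comp, h, Category.id_comp]

/-- `G` is a projective object such that every projective object is in `add G`. -/
def IsProjectiveAddGenerator (G : C) : Prop :=
  Projective G ∧ ∀ P : C, Projective P → addClosure (ObjectProperty.singleton G) P

/-- The witness is `U ⊞ G ⊞ K` with `K` a first syzygy of `U`. It is chosen before the length and
the objects, as needed for a uniform bound. -/
lemma exists_syzygy_closure [EnoughProjectives C] {G : C} (hG : IsProjectiveAddGenerator G)
    (U : C) : ∃ U', addClosure (.singleton U) ≤ addClosure (.singleton U') ∧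
      (∀ P, Projective P → addClosure (.singleton U') P) ∧
      ∀ (m : ℕ) (X W : C), HasExactResolution (addClosure (.singleton U)) m X →
        IsSyzygy X 1 W → HasExactResolution (addClosure (.singleton U')) m W := by
  obtain ⟨K, hK⟩ := exists_isSyzygy_one U
  have r₁ : Retract U ((U ⊞ G) ⊞ K) := ⟨biprod.inl ≫ biprod.inl, biprod.fst ≫ biprod.fst, by simp⟩
  have r₂ : Retract G ((U ⊞ G) ⊞ K) := ⟨biprod.inr ≫ biprod.inl, biprod.fst ≫ biprod.snd, by simp⟩
  have r₃ : Retract K ((U ⊞ G) ⊞ K) := ⟨biprod.inr, biprod.snd, by simp⟩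
  have hA := isAddClosed_addClosure (ObjectProperty.singleton ((U ⊞ G) ⊞ K))
  have hs := addClosure_singleton_self ((U ⊞ G) ⊞ K)
  have hproj : ∀ P, Projective P → addClosure (.singleton ((U ⊞ G) ⊞ K)) P := fun P hP =>
    addClosure_singleton_le hA (hA.retract r₂ hs) _ (hG.2 P hP)
  refine ⟨(U ⊞ G) ⊞ K, addClosure_singleton_le hA (hA.retract r₁ hs), hproj,
    fun m X W hX hW => hX.of_isSyzygy_one hA hproj ?_ hW⟩
  intro X hX
  obtain rfl := (ObjectProperty.singleton_iff _ _).1 hX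
  exact ⟨K, hK, hA.retract r₃ hs⟩

/-- An extension of two objects with `add U`-resolutions of lengths `m'` and `m` has a resolution
of length `m + m' + 1`. -/
lemma HasExactResolution.of_isExtension [EnoughProjectives C] {G : C}
    (hG : IsProjectiveAddGenerator G) (m : ℕ) (U : C) :
    ∃ U', addClosure (.singleton U) ≤ addClosure (.singleton U') ∧
      (∀ P, Projective P → addClosure (.singleton U') P) ∧
      ∀ (m' : ℕ) (X Y Z : C), IsExtension X Y Z →
        HasExactResolution (addClosure (.singleton U)) m X →
        HasExactResolution (addClosure (.singleton U)) m' Z →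
        HasExactResolution (addClosure (.singleton U')) (m + m' + 1) Y := by
  -- `U'` may depend on `m` and `U` but not on `m'` or on the extension. Each step enlarges `U`,
  -- which is why `U` is generalized.
  induction m generalizing U with
  | zero =>
    obtain ⟨U', hU, hproj, hsyz⟩ := exists_syzygy_closure hG U
    refine ⟨U', hU, hproj, fun m' X Y Z h hX hZ => ?_⟩
    obtain ⟨M, hM⟩ := exists_isSyzygy_one Z
    obtain ⟨P, hP, _⟩ := (isSyzygy_one_iff _ _).1 hM
    -- Covering `X` by itself with kernel zero makes `Y₁` isomorphic to the syzygy `M` of `Z`. So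
    -- `Y` is covered by `X ⊞ P` with a kernel that has a resolution of length `m'`.
    obtain ⟨Y₁, ⟨f, g, w, h₁⟩, h₂⟩ :=
      h.horseshoe (IsExtension.of_isZero_of_iso (isZero_zero C) (Iso.refl X)) hP
    have : IsIso g := h₁.isIso_g_iff.2 (isZero_zero C)
    have hA := isAddClosed_addClosure (ObjectProperty.singleton U')
    rw [zero_add]
    exact (hasExactResolution_succ_iff _ _ _).2
      ⟨Y₁, _, h₂, hA.biprod (hU _ hX) (hproj P inferInstance),
        (hsyz _ _ _ hZ hM).of_iso hA (asIso g).symm⟩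
  | succ m ih =>
    obtain ⟨U₁, hU₁, hproj₁, hsyz⟩ := exists_syzygy_closure hG U
    obtain ⟨U', hU', hproj, ih⟩ := ih U₁
    refine ⟨U', hU₁.trans hU', hproj, fun m' X Y Z h hX hZ => ?_⟩
    obtain ⟨X₁, U₀, hX₁, hU₀, hX⟩ := (hasExactResolution_succ_iff _ _ _).1 hX
    obtain ⟨M, hM⟩ := exists_isSyzygy_one Z
    obtain ⟨P, hP, _⟩ := (isSyzygy_one_iff _ _).1 hM
    -- `Y₁` is an extension of `M` by `X₁`. The resolution of `X₁` is shorter by one, and `M` keeps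
    -- the length `m'` at the price of passing from `U` to `U₁`.
    obtain ⟨Y₁, h₁, h₂⟩ := h.horseshoe hX₁ hP
    have hA := isAddClosed_addClosure (ObjectProperty.singleton U')
    rw [show m + 1 + m' + 1 = (m + m' + 1) + 1 by lia]
    exact (hasExactResolution_succ_iff _ _ _).2
      ⟨Y₁, _, h₂, hA.biprod (hU' _ (hU₁ _ hU₀)) (hproj P inferInstance),
        ih m' _ _ _ h₁ (hX.mono hU₁) (hsyz _ _ _ hZ hM)⟩

end Syzygies

/-! ### Comparing abelian categories along exact functors -/

section Comparison

lemma iInf_le_iInf_of_imp {P Q : ℕ → Prop} (h : ∀ n, P n → Q n) :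
    ⨅ (n : ℕ) (_ : Q n), (n : ℕ∞) ≤ ⨅ (n : ℕ) (_ : P n), (n : ℕ∞) :=
  le_iInf₂ fun n hn => iInf₂_le n (h n hn)

lemma iInf_le_two_mul_iInf_add_one {P Q : ℕ → Prop} (h : ∀ n, P n → Q (2 * n + 1)) :
    ⨅ (n : ℕ) (_ : Q n), (n : ℕ∞) ≤ 2 * (⨅ (n : ℕ) (_ : P n), (n : ℕ∞)) + 1 := by
  classical
  by_cases hP : ∃ n, P n
  · have h1 : ⨅ (n : ℕ) (_ : P n), (n : ℕ∞) = (Nat.find hP : ℕ∞) :=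
      le_antisymm (iInf₂_le _ (Nat.find_spec hP))
        (le_iInf₂ fun n hn => by exact_mod_cast Nat.find_min' hP hn)
    rw [h1]
    exact (iInf₂_le _ (h _ (Nat.find_spec hP))).trans (by push_cast; rfl)
  · have h1 : ⨅ (n : ℕ) (_ : P n), (n : ℕ∞) = ⊤ := by
      simp only [iInf_eq_top]
      exact fun n hn => (hP ⟨n, hn⟩).elim
    rw [h1]
    simp

variable {C : Type u} [Category.{v} C] [Abelian C] {D : Type u} [Category.{v} D] [Abelian D]

/-- The image under `e` of a resolution of a syzygy of `i B` is a resolution of a syzygy of `B`;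
preservation of projectives by `e` is what keeps syzygies syzygies. -/
lemma isIgusaTodorovCategory_of_section {D : Type*} [Category D] [Abelian D]
    (i : D ⥤ C) (e : C ⥤ D) [e.Additive]
    [PreservesFiniteLimits e] [PreservesFiniteColimits e] (iso : i ⋙ e ≅ 𝟭 D)
    (hproj : ∀ P, Projective P → Projective (e.obj P)) {m n : ℕ}
    (h : IsIgusaTodorovCategory C m n) : IsIgusaTodorovCategory D m n := by
  obtain ⟨U, hU⟩ := h
  refine ⟨e.obj U, fun B => ?_⟩
  obtain ⟨K, hK, hK'⟩ := hU (i.obj B)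
  exact ⟨e.obj K, (hK.map e hproj).of_iso_left (iso.app B),
    hK'.map e fun X hX => addClosure_map e (singleton_map e U) hX⟩

lemma extensionLayer_eq_top_of_section {D : Type*} [Category D] [Abelian D]
    (i : D ⥤ C) (e : C ⥤ D) [e.Additive]
    [PreservesFiniteLimits e] [PreservesFiniteColimits e] (iso : i ⋙ e ≅ 𝟭 D) {n : ℕ} {T : C}
    (h : extensionLayer (ObjectProperty.singleton T) (n + 1) = ⊤) :
    extensionLayer (ObjectProperty.singleton (e.obj T)) (n + 1) = ⊤ := by
  rw [eq_top_iff]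
  rintro B -
  have h1 : extensionLayer (ObjectProperty.singleton T) (n + 1) (i.obj B) := by rw [h]; trivial
  exact (isAddClosed_extensionLayer _ _).iso (iso.app B)
    (extensionLayer_map e (singleton_map e T) n h1)

/-- An `n`-th syzygy over `D` has to be pushed one syzygy further in `C`, since inflated projectives
only have projective dimension at most one; this accounts for `n + 1`. Joining the resolutions of
the two ends of an extension accounts for `m + m + 1`. -/
lemma isIgusaTodorovCategory_of_isExtension {D : Type*} [Category D] [Abelian D]
    [EnoughProjectives C] {G : C} (hG : IsProjectiveAddGenerator G)
    (i : D ⥤ C) [i.Additive] [PreservesFiniteLimits i] [PreservesFiniteColimits i]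
    (hi : ∀ P, Projective P → ∃ Q, Projective Q ∧ IsSyzygy (i.obj P) 1 Q)
    (hext : ∀ A : C, ∃ B B' : D, IsExtension (i.obj B) A (i.obj B')) {m n : ℕ}
    (h : IsIgusaTodorovCategory D m n) : IsIgusaTodorovCategory C (2 * m + 1) (n + 1) := by
  obtain ⟨U, hU⟩ := h
  obtain ⟨U₁, -, -, hU₁⟩ := exists_syzygy_closure hG (i.obj U)
  obtain ⟨U₂, -, -, hU₂⟩ := HasExactResolution.of_isExtension hG m U₁
  have key : ∀ B : D, ∃ W, IsSyzygy (i.obj B) (n + 1) W ∧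
      HasExactResolution (addClosure (.singleton U₁)) m W := fun B => by
    obtain ⟨K, hK, hK'⟩ := hU B
    obtain ⟨W, hW⟩ := exists_isSyzygy_one (i.obj K)
    exact ⟨W, hK.succ_map i hi hW,
      hU₁ _ _ _ (hK'.map i fun X hX => addClosure_map i (singleton_map i U) hX) hW⟩
  refine ⟨U₂, fun A => ?_⟩
  obtain ⟨B, B', hA⟩ := hext A
  obtain ⟨W, hW, hW'⟩ := key B
  obtain ⟨M, hM, hM'⟩ := key B'
  obtain ⟨L, hL, hL'⟩ := IsSyzygy.horseshoe hA hW hM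
  refine ⟨L, hL', ?_⟩
  rw [two_mul]
  exact hU₂ m _ _ _ hL hW' hM'

lemma extensionLayer_eq_top_of_isExtension {D : Type*} [Category D] [Abelian D]
    (i : D ⥤ C) [i.Additive] [PreservesFiniteLimits i] [PreservesFiniteColimits i]
    (hext : ∀ A : C, ∃ B B' : D, IsExtension (i.obj B) A (i.obj B')) {n : ℕ} {T : D}
    (h : extensionLayer (ObjectProperty.singleton T) (n + 1) = ⊤) :
    extensionLayer (ObjectProperty.singleton (i.obj T)) (2 * n + 1 + 1) = ⊤ := by
  rw [eq_top_iff]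
  rintro A -
  obtain ⟨B, B', hA⟩ := hext A
  have key : ∀ B, extensionLayer (ObjectProperty.singleton (i.obj T)) (n + 1) (i.obj B) :=
    fun B => extensionLayer_map i (singleton_map i T) n (by rw [h]; trivial)
  rw [two_mul]
  exact extensionLayer_of_isExtension _ n n hA (key B) (key B')

end Comparison

universe u' v' w'

/-! ### Comparing Rouquier dimensions along triangulated functors -/

section Triangulated

open Pretriangulated Triangulated ObjectProperty

lemma retractClosure_le_inverseImage {C : Type*} [Category C] {D : Type*} [Category D]
    (F : C ⥤ D) {P : ObjectProperty C} {P' : ObjectProperty D}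
    (h : P ≤ P'.inverseImage F) : P.retractClosure ≤ P'.retractClosure.inverseImage F := by
  rintro X ⟨Y, hY, ⟨r⟩⟩
  exact ⟨F.obj Y, h _ hY, ⟨r.map F⟩⟩

variable {𝒯 : Type*} [Category 𝒯] [HasZeroObject 𝒯] [HasShift 𝒯 ℤ] [Preadditive 𝒯]
  [∀ n : ℤ, (shiftFunctor 𝒯 n).Additive] [Pretriangulated 𝒯]
  {𝒯' : Type*} [Category 𝒯'] [HasZeroObject 𝒯'] [HasShift 𝒯' ℤ] [Preadditive 𝒯']
  [∀ n : ℤ, (shiftFunctor 𝒯' n).Additive] [Pretriangulated 𝒯']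

lemma triangEnvelopeIter_le_inverseImage (F : 𝒯 ⥤ 𝒯') [F.CommShift ℤ] [F.IsTriangulated]
    {P : ObjectProperty 𝒯} {P' : ObjectProperty 𝒯'} (h : P ≤ P'.inverseImage F) (n : ℕ) :
    P.triangEnvelopeIter n ≤ (P'.triangEnvelopeIter n).inverseImage F := by
  have h₁ : P.shiftClosure ℤ ≤ (P'.shiftClosure ℤ).inverseImage F := by
    rw [shiftClosure_le_iff]
    exact h.trans fun X hX => le_shiftClosure _ _ hX
  have h₂ : (P.shiftClosure ℤ).binaryProductsClosure ≤
      (P'.shiftClosure ℤ).binaryProductsClosure.inverseImage F :=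
    limitsClosure_le (h₁.trans fun X hX => le_limitsClosure _ _ _ hX)
  have h₃ := retractClosure_le_inverseImage F h₂
  induction n with
  | zero => simpa only [triangEnvelopeIter_zero] using h₃
  | succ n ih =>
    rw [triangEnvelopeIter_succ, triangEnvelopeIter_succ]
    refine retractClosure_le_inverseImage F ?_
    rintro X ⟨Y, Z, f, g, d, hT, hY, hZ⟩
    exact ⟨_, _, _, _, _, F.map_distinguished _ hT, h₃ _ hY, ih _ hZ⟩

lemma triangEnvelopeIter_eq_top_of_essSurj (F : 𝒯 ⥤ 𝒯') [F.CommShift ℤ] [F.IsTriangulated]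
    [F.EssSurj] {T : 𝒯} {n : ℕ} (h : (ObjectProperty.singleton T).triangEnvelopeIter n = ⊤) :
    (ObjectProperty.singleton (F.obj T)).triangEnvelopeIter n = ⊤ := by
  rw [eq_top_iff]
  rintro Y -
  refine ObjectProperty.prop_of_iso _ (F.objObjPreimageIso Y)
    (triangEnvelopeIter_le_inverseImage F (singleton_map F T) n _ ?_)
  rw [h]
  trivial

lemma triangEnvelopeIter_eq_top_of_triangle [IsTriangulated 𝒯'] (F : 𝒯 ⥤ 𝒯') [F.CommShift ℤ]
    [F.IsTriangulated]
    (hF : ∀ X : 𝒯', ∃ (A B : 𝒯) (f : F.obj A ⟶ X) (g : X ⟶ F.obj B)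
      (d : F.obj B ⟶ (F.obj A)⟦(1 : ℤ)⟧), Triangle.mk f g d ∈ distTriang 𝒯')
    {T : 𝒯} {n : ℕ} (h : (ObjectProperty.singleton T).triangEnvelopeIter n = ⊤) :
    (ObjectProperty.singleton (F.obj T)).triangEnvelopeIter (2 * n + 1) = ⊤ := by
  rw [eq_top_iff]
  rintro X -
  obtain ⟨A, B, f, g, d, hT⟩ := hF X
  have key : ∀ A, (ObjectProperty.singleton (F.obj T)).triangEnvelopeIter n (F.obj A) := fun A =>
    triangEnvelopeIter_le_inverseImage F (singleton_map F T) n _ (by rw [h]; trivial)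
  -- `triangEnvelopeIter` counts extensions, not layers: each end uses `n` of them, and the triangle
  -- joining the ends is one more.
  rw [show 2 * n + 1 = n + (n + 1) by lia, triangEnvelopeIter_add' _ rfl]
  exact le_retractClosure _ _ ⟨_, _, f, g, d, hT, key A, key B⟩

/-- A distinguished triangle between objects of a triangulated subcategory is distinguished in the
subcategory. -/
lemma exists_distinguished_fullSubcategory (P : ObjectProperty 𝒯) [P.IsTriangulated]
    {X Y Z : P.FullSubcategory} {T : Triangle 𝒯} (hT : T ∈ distTriang 𝒯) (e₁ : X.obj ≅ T.obj₁)
    (e₂ : Y.obj ≅ T.obj₂) (e₃ : Z.obj ≅ T.obj₃) :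
    ∃ (f : X ⟶ Y) (g : Y ⟶ Z) (d : Z ⟶ X⟦(1 : ℤ)⟧),
      Triangle.mk f g d ∈ distTriang P.FullSubcategory := by
  let f : X ⟶ Y := P.fullyFaithfulι.preimage (e₁.hom ≫ T.mor₁ ≫ e₂.inv)
  let g : Y ⟶ Z := P.fullyFaithfulι.preimage (e₂.hom ≫ T.mor₂ ≫ e₃.inv)
  let d : Z ⟶ X⟦(1 : ℤ)⟧ := P.fullyFaithfulι.preimage
    (e₃.hom ≫ T.mor₃ ≫ e₁.inv⟦(1 : ℤ)⟧' ≫ (P.ι.commShiftIso (1 : ℤ)).inv.app X)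
  have hf : P.ι.map f = e₁.hom ≫ T.mor₁ ≫ e₂.inv := P.fullyFaithfulι.map_preimage _
  have hg : P.ι.map g = e₂.hom ≫ T.mor₂ ≫ e₃.inv := P.fullyFaithfulι.map_preimage _
  have hd : P.ι.map d = e₃.hom ≫ T.mor₃ ≫ e₁.inv⟦(1 : ℤ)⟧' ≫
    (P.ι.commShiftIso (1 : ℤ)).inv.app X := P.fullyFaithfulι.map_preimage _
  refine ⟨f, g, d, ?_⟩
  rw [← P.ι.map_distinguished_iff]
  refine isomorphic_distinguished _ hT _ (Triangle.isoMk _ _ e₁ e₂ e₃ ?_ ?_ ?_)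
  · change P.ι.map f ≫ e₂.hom = e₁.hom ≫ T.mor₁
    rw [hf, Category.assoc, Category.assoc, e₂.inv_hom_id, Category.comp_id]
  · change P.ι.map g ≫ e₃.hom = e₂.hom ≫ T.mor₂
    rw [hg, Category.assoc, Category.assoc, e₃.inv_hom_id, Category.comp_id]
  · change (P.ι.map d ≫ (P.ι.commShiftIso (1 : ℤ)).hom.app X) ≫ e₁.hom⟦(1 : ℤ)⟧' =
      e₃.hom ≫ T.mor₃
    rw [hd]
    simp only [Category.assoc, Iso.inv_hom_id_app_assoc]
    rw [← Functor.map_comp, e₁.inv_hom_id, CategoryTheory.Functor.map_id, Category.comp_id]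

end Triangulated

/-! ### Bounded derived categories -/

section Derived

open DerivedCategory Pretriangulated Triangulated

variable {C : Type u} [Category.{v} C] [Abelian C] [HasDerivedCategory.{w} C]
  {D : Type u'} [Category.{v'} D] [Abelian D] [HasDerivedCategory.{w'} D]

/-- A strictly bounded representative stays strictly bounded under termwise application of any
functor preserving zero morphisms, exact or not. -/
lemma bounded_iff (X : DerivedCategory C) :
    (TStructure.t (C := C)).bounded X ↔ ∃ (K : CochainComplex C ℤ) (a b : ℤ),
      K.IsStrictlyGE a ∧ K.IsStrictlyLE b ∧ Nonempty (X ≅ Q.obj K) := by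
  constructor
  · rintro ⟨⟨a, _⟩, ⟨b, _⟩⟩
    obtain ⟨K, h, h', e⟩ := X.exists_iso_Q_obj_of_isGE_of_isLE a b
    exact ⟨K, a, b, h, h', e⟩
  · rintro ⟨K, a, b, _, _, ⟨e⟩⟩
    exact ⟨⟨a, TStructure.t.isGE_of_iso e.symm a⟩, ⟨b, TStructure.t.isLE_of_iso e.symm b⟩⟩

omit [HasDerivedCategory.{w} C] [HasDerivedCategory.{w'} D] in
lemma isStrictlyGE_mapHomologicalComplex (F : C ⥤ D) [F.PreservesZeroMorphisms]
    (K : CochainComplex C ℤ) (a : ℤ) [K.IsStrictlyGE a] :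
    CochainComplex.IsStrictlyGE ((F.mapHomologicalComplex (.up ℤ)).obj K) a := by
  rw [CochainComplex.isStrictlyGE_iff]
  intro i hi
  exact F.map_isZero (K.isZero_of_isStrictlyGE a i hi)

omit [HasDerivedCategory.{w} C] [HasDerivedCategory.{w'} D] in
lemma isStrictlyLE_mapHomologicalComplex (F : C ⥤ D) [F.PreservesZeroMorphisms]
    (K : CochainComplex C ℤ) (a : ℤ) [K.IsStrictlyLE a] :
    CochainComplex.IsStrictlyLE ((F.mapHomologicalComplex (.up ℤ)).obj K) a := by
  rw [CochainComplex.isStrictlyLE_iff]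
  intro i hi
  exact F.map_isZero (K.isZero_of_isStrictlyLE a i hi)

section

variable (F : C ⥤ D) [F.Additive] [PreservesFiniteLimits F] [PreservesFiniteColimits F]

lemma bounded_mapDerivedCategory (X : DerivedCategory.Bounded C) :
    (TStructure.t (C := D)).bounded ((Bounded.ι ⋙ F.mapDerivedCategory).obj X) := by
  obtain ⟨K, a, b, _, _, ⟨e⟩⟩ := (bounded_iff _).1 X.property
  exact (bounded_iff _).2 ⟨(F.mapHomologicalComplex _).obj K, a, b,
    isStrictlyGE_mapHomologicalComplex F K a, isStrictlyLE_mapHomologicalComplex F K b,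
    ⟨F.mapDerivedCategory.mapIso e ≪≫ F.mapDerivedCategoryFactors.app K⟩⟩

/-- The functor between bounded derived categories induced by an exact functor. -/
abbrev CategoryTheory.Functor.mapBoundedDerivedCategory :
    DerivedCategory.Bounded C ⥤ DerivedCategory.Bounded D :=
  TStructure.t.bounded.lift (Bounded.ι ⋙ F.mapDerivedCategory) (bounded_mapDerivedCategory F)

lemma exists_bounded (K : CochainComplex C ℤ) (a b : ℤ) [K.IsStrictlyGE a] [K.IsStrictlyLE b] :
    ∃ X : DerivedCategory.Bounded C, X.obj = Q.obj K :=
  ⟨⟨Q.obj K, (bounded_iff _).2 ⟨K, a, b, ‹_›, ‹_›, ⟨Iso.refl _⟩⟩⟩, rfl⟩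

/-- The section `i` is applied termwise to a complex representing the object, so additivity of `i`
is enough for a preimage. -/
lemma essSurj_mapBoundedDerivedCategory (i : D ⥤ C) [i.Additive] (iso : i ⋙ F ≅ 𝟭 D) :
    F.mapBoundedDerivedCategory.EssSurj where
  mem_essImage Y := by
    obtain ⟨K, a, b, _, _, ⟨e⟩⟩ := (bounded_iff _).1 Y.property
    have := isStrictlyGE_mapHomologicalComplex i K a
    have := isStrictlyLE_mapHomologicalComplex i K b
    obtain ⟨X, hX⟩ := exists_bounded ((i.mapHomologicalComplex (.up ℤ)).obj K) a b
    refine ⟨X, ⟨TStructure.t.bounded.isoMk ?_⟩⟩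
    refine F.mapDerivedCategory.mapIso (eqToIso hX) ≪≫ F.mapDerivedCategoryFactors.app _ ≪≫
      Q.mapIso ?_ ≪≫ e.symm
    exact HomologicalComplex.Hom.isoOfComponents (fun n => iso.app (K.X n))
      (fun n m _ => (iso.hom.naturality (K.d n m)).symm)

end

/-- If the identity functor is an extension of functors which factor through an exact functor
`i : D ⥤ C`, then every object of the bounded derived category of `C` is an extension of objects in
the image of the bounded derived category of `D`. -/
lemma exists_distinguished_mapBoundedDerivedCategory (i : D ⥤ C) [i.Additive]
    [PreservesFiniteLimits i] [PreservesFiniteColimits i] (T₁ T₂ : C ⥤ D) [T₁.Additive]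
    [T₂.Additive] (α : T₁ ⋙ i ⟶ 𝟭 C) (β : 𝟭 C ⟶ T₂ ⋙ i) (w : α ≫ β = 0)
    (h : ∀ A, (ShortComplex.mk (α.app A) (β.app A) (NatTrans.congr_app w A)).ShortExact)
    (X : DerivedCategory.Bounded C) :
    ∃ (A B : DerivedCategory.Bounded D) (f : i.mapBoundedDerivedCategory.obj A ⟶ X)
      (g : X ⟶ i.mapBoundedDerivedCategory.obj B)
      (d : i.mapBoundedDerivedCategory.obj B ⟶ (i.mapBoundedDerivedCategory.obj A)⟦(1 : ℤ)⟧),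
      Triangle.mk f g d ∈ distTriang (DerivedCategory.Bounded C) := by
  obtain ⟨K, a, b, _, _, ⟨e⟩⟩ := (bounded_iff _).1 X.property
  have := isStrictlyGE_mapHomologicalComplex T₁ K a
  have := isStrictlyLE_mapHomologicalComplex T₁ K b
  have := isStrictlyGE_mapHomologicalComplex T₂ K a
  have := isStrictlyLE_mapHomologicalComplex T₂ K b
  -- `T₁` and `T₂` are not assumed exact, so they act on the chosen complex `K` and not on `X`. The
  -- degreewise exact sequence of complexes then gives the triangle.
  let K₁ := (i.mapHomologicalComplex (.up ℤ)).obj ((T₁.mapHomologicalComplex (.up ℤ)).obj K)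
  let K₂ := (i.mapHomologicalComplex (.up ℤ)).obj ((T₂.mapHomologicalComplex (.up ℤ)).obj K)
  let f : K₁ ⟶ K :=
    { f := fun n => α.app (K.X n)
      comm' := fun n m _ => (α.naturality (K.d n m)).symm }
  let g : K ⟶ K₂ :=
    { f := fun n => β.app (K.X n)
      comm' := fun n m _ => (β.naturality (K.d n m)).symm }
  let S := ShortComplex.mk f g (by
    ext n
    exact NatTrans.congr_app w (K.X n))
  have hS : S.ShortExact :=
    HomologicalComplex.shortExact_of_degreewise_shortExact S fun n => h (K.X n)
  obtain ⟨A, hA⟩ := exists_bounded ((T₁.mapHomologicalComplex (.up ℤ)).obj K) a b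
  obtain ⟨B, hB⟩ := exists_bounded ((T₂.mapHomologicalComplex (.up ℤ)).obj K) a b
  let eA : (i.mapBoundedDerivedCategory.obj A).obj ≅ Q.obj K₁ :=
    i.mapDerivedCategory.mapIso (eqToIso hA) ≪≫ i.mapDerivedCategoryFactors.app _
  let eB : (i.mapBoundedDerivedCategory.obj B).obj ≅ Q.obj K₂ :=
    i.mapDerivedCategory.mapIso (eqToIso hB) ≪≫ i.mapDerivedCategoryFactors.app _
  refine ⟨A, B, exists_distinguished_fullSubcategory _
    (triangleOfSES_distinguished hS) eA e eB⟩

end Derived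

/-! ### Finitely generated modules and restriction of scalars -/

namespace FGModuleCat

variable {R : Type u} [Ring R]

section Noetherian

variable [IsNoetherianRing R]

lemma shortExact_iff (S : ShortComplex (FGModuleCat.{u} R)) :
    S.ShortExact ↔ Function.Injective S.f.hom.hom ∧ Function.Surjective S.g.hom.hom ∧
      Function.Exact S.f.hom.hom S.g.hom.hom := by
  have : PreservesFiniteLimits (ModuleCat.isFG.{u} R).ι :=
    inferInstanceAs (PreservesFiniteLimits (forget₂ (FGModuleCat R) (ModuleCat.{u} R)))
  have : PreservesFiniteColimits (ModuleCat.isFG.{u} R).ι :=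
    inferInstanceAs (PreservesFiniteColimits (forget₂ (FGModuleCat R) (ModuleCat.{u} R)))
  rw [← ShortExact.shortExact_map_iff (ModuleCat.isFG.{u} R).ι]
  constructor
  · intro h
    exact ⟨h.moduleCat_injective_f, h.moduleCat_surjective_g,
      (ShortComplex.ShortExact.moduleCat_exact_iff_function_exact _).1 h.exact⟩
  · rintro ⟨h₁, h₂, h₃⟩
    exact ShortComplex.ShortExact.mk'
      ((ShortComplex.ShortExact.moduleCat_exact_iff_function_exact _).2 h₃)
      ((ModuleCat.mono_iff_injective _).2 h₁) ((ModuleCat.epi_iff_surjective _).2 h₂)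

omit [IsNoetherianRing R] in
lemma epi_iff_surjective {X Y : FGModuleCat.{u} R} (f : X ⟶ Y) :
    Epi f ↔ Function.Surjective f.hom.hom := by
  have : PreservesFiniteColimits (ModuleCat.isFG.{u} R).ι :=
    inferInstanceAs (PreservesFiniteColimits (forget₂ (FGModuleCat R) (ModuleCat.{u} R)))
  constructor
  · intro h
    exact (ModuleCat.epi_iff_surjective ((ModuleCat.isFG.{u} R).ι.map f)).1 inferInstance
  · intro h
    have : Epi ((ModuleCat.isFG.{u} R).ι.map f) := (ModuleCat.epi_iff_surjective _).2 h
    exact (ModuleCat.isFG.{u} R).ι.epi_of_epi_map this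

instance projective_of (P : Type u) [AddCommGroup P] [Module R P] [Module.Finite R P]
    [Module.Projective R P] : Projective (FGModuleCat.of R P) where
  factors {E X} f e he := by
    obtain ⟨g, hg⟩ := Module.projective_lifting_property e.hom.hom f.hom.hom
      ((epi_iff_surjective e).1 he)
    exact ⟨ObjectProperty.homMk (ModuleCat.ofHom g), by ext x; exact LinearMap.congr_fun hg x⟩

omit [IsNoetherianRing R] in
lemma exists_epi_pi (M : FGModuleCat.{u} R) :
    ∃ (n : ℕ) (f : FGModuleCat.of R (Fin n → R) ⟶ M), Epi f := by
  obtain ⟨n, f, hf⟩ := Module.Finite.exists_fin' R M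
  exact ⟨n, ObjectProperty.homMk (ModuleCat.ofHom f), (epi_iff_surjective _).2 hf⟩

instance : EnoughProjectives (FGModuleCat.{u} R) where
  presentation M := by
    obtain ⟨n, f, hf⟩ := exists_epi_pi M
    exact ⟨{ p := _, projective := projective_of _, f := f, epi := hf }⟩

omit [IsNoetherianRing R] in
lemma hom_hom_sum_apply {X Y : FGModuleCat.{u} R} {ι : Type*} (s : Finset ι) (f : ι → (X ⟶ Y))
    (x : X) : (∑ i ∈ s, f i).hom.hom x = ∑ i ∈ s, (f i).hom.hom x := by
  classical
  induction s using Finset.induction_on with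
  | empty => rfl
  | insert i s hi ih =>
    rw [Finset.sum_insert hi, Finset.sum_insert hi, ← ih]
    rfl

lemma addClosure_of_linearMap {X F : Type u} [AddCommGroup X] [Module R X] [Module.Finite R X]
    [AddCommGroup F] [Module R F] [Module.Finite R F] {n : ℕ} (p : Fin n → X →ₗ[R] F)
    (q : Fin n → F →ₗ[R] X) (h : ∀ x, ∑ i, q i (p i x) = x) :
    addClosure (.singleton (FGModuleCat.of R F)) (FGModuleCat.of R X) :=
  addClosure_of_fintype (fun _ : Fin n => FGModuleCat.of R F)
    (fun i => FGModuleCat.ofHom (p i)) (fun i => FGModuleCat.ofHom (q i))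
    (fun _ => (ObjectProperty.singleton_iff _ _).2 rfl) (by
      refine FGModuleCat.hom_ext (LinearMap.ext fun x => ?_)
      rw [hom_hom_sum_apply]
      exact h x)

lemma addClosure_pi (n : ℕ) :
    addClosure (.singleton (FGModuleCat.of R R)) (FGModuleCat.of R (Fin n → R)) :=
  addClosure_of_linearMap (fun i => LinearMap.proj i) (fun i => LinearMap.single R (fun _ => R) i)
    fun x => by simpa using Finset.univ_sum_single x

lemma isProjectiveAddGenerator_self : IsProjectiveAddGenerator (FGModuleCat.of R R) := by
  refine ⟨inferInstance, fun P hP => ?_⟩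
  obtain ⟨n, f, hf⟩ := exists_epi_pi P
  exact (isAddClosed_addClosure _).retract
    ⟨Projective.factorThru (𝟙 P) f, f, Projective.factorThru_comp _ _⟩ (addClosure_pi n)

end Noetherian

/-- Restriction of scalars between categories of finitely generated modules. -/
def restriction {S : Type u} [Ring S] (f : R →+* S)
    (hf : ∀ M : FGModuleCat.{u} S, Module.Finite R ((ModuleCat.restrictScalars f).obj M.obj)) :
    FGModuleCat.{u} S ⥤ FGModuleCat.{u} R :=
  (ModuleCat.isFG R).lift ((ModuleCat.isFG S).ι ⋙ ModuleCat.restrictScalars f) hf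

variable {S : Type u} [Ring S] (f : R →+* S)
    (hf : ∀ M : FGModuleCat.{u} S, Module.Finite R ((ModuleCat.restrictScalars f).obj M.obj))

instance : (restriction f hf).Additive where
  map_add := rfl

variable [IsNoetherianRing R] [IsNoetherianRing S]

/-- Short exactness depends only on the underlying maps, which restriction of scalars does not
change. -/
lemma restriction_exact :
    PreservesFiniteLimits (restriction f hf) ∧ PreservesFiniteColimits (restriction f hf) := by
  refine ((Functor.exact_tfae (restriction f hf)).out 0 3).1 fun T hT => ?_
  rw [shortExact_iff] at hT ⊢
  exact hT

instance : PreservesFiniteLimits (restriction f hf) := (restriction_exact f hf).1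

instance : PreservesFiniteColimits (restriction f hf) := (restriction_exact f hf).2

end FGModuleCat

/-! ### Cleft extensions with square-zero projective kernel -/

namespace FGModuleCat

section SquareZero

variable {R S : Type u} [Ring R] [Ring S] (π : R →+* S) (σ : S →+* R)

lemma finite_restrictScalars_of_surjective (hπ : Function.Surjective π) (M : FGModuleCat.{u} S) :
    Module.Finite R ((ModuleCat.restrictScalars π).obj M.obj) := by
  obtain ⟨s, hs⟩ := Module.Finite.fg_top (R := S) (M := M.obj)
  let s' : Finset ((ModuleCat.restrictScalars π).obj M.obj) := s
  let N := Submodule.span R (s' : Set ((ModuleCat.restrictScalars π).obj M.obj))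
  refine ⟨⟨s', eq_top_iff.2 ?_⟩⟩
  rintro x -
  have hx : (show M.obj from x) ∈ Submodule.span S (s : Set M.obj) := by rw [hs]; trivial
  refine Submodule.span_induction (p := fun (y : M.obj) _ => y ∈ N) ?_ ?_ ?_ ?_ hx
  · exact fun y hy => Submodule.subset_span hy
  · exact Submodule.zero_mem _
  · exact fun y z _ _ hy hz => Submodule.add_mem _ hy hz
  · intro a y _ hy
    obtain ⟨r, rfl⟩ := hπ a
    exact N.smul_mem r hy

variable {π σ} (hπσ : ∀ s, π (σ s) = s) (hJ : ∀ x y, π x = 0 → π y = 0 → x * y = 0)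

include hπσ

lemma sub_mem_ker (r : R) : π (r - σ (π r)) = 0 := by
  rw [map_sub, hπσ, sub_self]

include hJ

/-- The difference `r - σ (π r)` lies in the kernel `J`, hence annihilates `J M` because `J² = 0`.
So `J M` is inflated from its own restriction along `σ`. -/
lemma smul_of_mem_ker_smul {M : Type*} [AddCommGroup M] [Module R M] (r : R) {x : M}
    (hx : x ∈ RingHom.ker π • (⊤ : Submodule R M)) : σ (π r) • x = r • x := by
  refine Submodule.smul_induction_on hx (fun a ha m _ => ?_) fun x y hx hy => ?_
  · have := hJ (r - σ (π r)) a (sub_mem_ker hπσ r) ha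
    rw [sub_mul, sub_eq_zero] at this
    rw [← mul_smul, ← mul_smul, this]
  · rw [smul_add, smul_add, hx, hy]

/-- If `s` generates `M` over `R` and `t` generates the kernel as a left ideal, then `s` together
with the products `t • s` generates `M` over `S`: split `r` as `σ (π r)` plus a kernel element, and
note that `r` and `σ (π r)` act alike on the kernel. -/
lemma finite_restrictScalars_section [IsNoetherianRing R] (M : FGModuleCat.{u} R) :
    Module.Finite S ((ModuleCat.restrictScalars σ).obj M.obj) := by
  classical
  obtain ⟨s, hs⟩ := Module.Finite.fg_top (R := R) (M := M.obj)
  obtain ⟨t, ht⟩ := IsNoetherian.noetherian (RingHom.ker π)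
  let A : Finset M.obj := s ∪ (t ×ˢ s).image fun x => x.1 • x.2
  let A' : Finset ((ModuleCat.restrictScalars σ).obj M.obj) := A
  let N := Submodule.span S (A' : Set ((ModuleCat.restrictScalars σ).obj M.obj))
  have hN : ∀ (a : S) (x : M.obj), x ∈ N → σ a • x ∈ N := fun a x hx => N.smul_mem a hx
  have hs' : ∀ x ∈ s, x ∈ N := fun x hx =>
    Submodule.subset_span (Finset.mem_coe.2 (Finset.mem_union_left _ hx))
  have ht' : ∀ a ∈ t, ∀ x ∈ s, a • x ∈ N := fun a ha x hx =>
    Submodule.subset_span (Finset.mem_coe.2 (Finset.mem_union_right _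
      (Finset.mem_image.2 ⟨(a, x), Finset.mem_product.2 ⟨ha, hx⟩, rfl⟩)))
  have h1 : ∀ x ∈ s, ∀ a ∈ RingHom.ker π, a • x ∈ N := by
    intro x hx a ha
    rw [← ht] at ha
    induction ha using Submodule.span_induction with
    | mem a ha => exact ht' a ha x hx
    | zero => rw [zero_smul]; exact N.zero_mem
    | add a b _ _ ha hb => rw [add_smul]; exact N.add_mem ha hb
    | smul r a ha' ha =>
      have h2 : a ∈ RingHom.ker π := by rw [← ht]; exact ha'
      have h3 := hJ _ _ (sub_mem_ker hπσ r) h2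
      rw [sub_mul, sub_eq_zero] at h3
      rw [smul_eq_mul, h3, mul_smul]
      exact hN _ _ ha
  have h2 : ∀ x ∈ s, ∀ r : R, r • x ∈ N := fun x hx r => by
    have : r • x = σ (π r) • x + (r - σ (π r)) • x := by rw [sub_smul]; abel
    rw [this]
    exact N.add_mem (hN _ _ (hs' x hx)) (h1 x hx _ (sub_mem_ker hπσ r))
  refine ⟨⟨A', eq_top_iff.2 ?_⟩⟩
  rintro x -
  have hx : (show M.obj from x) ∈ Submodule.span R (s : Set M.obj) := by rw [hs]; trivial
  have : ∀ r : R, r • (show M.obj from x) ∈ N := by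
    refine Submodule.span_induction (p := fun (y : M.obj) _ => ∀ r : R, r • y ∈ N)
      h2 ?_ ?_ ?_ hx
    · intro r; rw [smul_zero]; exact N.zero_mem
    · intro y z _ _ hy hz r; rw [smul_add]; exact N.add_mem (hy r) (hz r)
    · intro a y _ hy r; rw [← mul_smul]; exact hy _
  have h3 := this 1
  rw [one_smul] at h3
  exact h3

end SquareZero

/-- A surjection of rings `R ⟶ S` with a section, such that the kernel is a projective left
module with square zero. -/
structure IsCleftExtension {R S : Type u} [Ring R] [Ring S] (π : R →+* S) (σ : S →+* R) :
    Prop where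
  map_section : ∀ s, π (σ s) = s
  mul_eq_zero : ∀ x y, π x = 0 → π y = 0 → x * y = 0
  projective : Module.Projective R (RingHom.ker π)

namespace IsCleftExtension

variable {R S : Type u} [Ring R] [Ring S] {π : R →+* S} {σ : S →+* R} (h : IsCleftExtension π σ)

include h in
lemma surjective : Function.Surjective π := fun s => ⟨σ s, h.map_section s⟩

/-- Restriction of scalars along the surjection. -/
abbrev inflation : FGModuleCat.{u} S ⥤ FGModuleCat.{u} R :=
  restriction π (finite_restrictScalars_of_surjective π h.surjective)

variable [IsNoetherianRing R]

/-- Restriction of scalars along the section. -/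
abbrev forgetful : FGModuleCat.{u} R ⥤ FGModuleCat.{u} S :=
  restriction σ (finite_restrictScalars_section h.map_section h.mul_eq_zero)

/-- Inflation followed by restriction along the section is the identity. -/
def inflationCompForgetful : h.inflation ⋙ h.forgetful ≅ 𝟭 (FGModuleCat.{u} S) :=
  NatIso.ofComponents
    (fun M => (ModuleCat.isFG S).isoMk
      { hom := ModuleCat.ofHom
          (X := (h.forgetful.obj (h.inflation.obj M)).obj) (Y := M.obj)
          { toFun := fun x => x
            map_add' := fun _ _ => rfl
            map_smul' := fun s x => by
              change π (σ s) • (show M.obj from x) = s • (show M.obj from x)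
              rw [h.map_section] }
        inv := ModuleCat.ofHom
          (X := M.obj) (Y := (h.forgetful.obj (h.inflation.obj M)).obj)
          { toFun := fun x => x
            map_add' := fun _ _ => rfl
            map_smul' := fun s x => by
              change s • (show M.obj from x) = π (σ s) • (show M.obj from x)
              rw [h.map_section] }
        hom_inv_id := rfl
        inv_hom_id := rfl })
    (fun f => rfl)

/-- The functor `M ↦ J M`, where `J` is the kernel of `π : R ⟶ S`. -/
def kerSMul (π : R →+* S) : FGModuleCat.{u} R ⥤ FGModuleCat.{u} R where
  obj M := FGModuleCat.of R (RingHom.ker π • (⊤ : Submodule R M.obj) : Submodule R M.obj)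
  map {M N} f := FGModuleCat.ofHom (f.hom.hom.restrict (by
    intro x hx
    have := Submodule.mem_map_of_mem (f := f.hom.hom) hx
    rw [Submodule.map_smul''] at this
    exact Submodule.smul_mono le_rfl le_top this))

/-- The functor `M ↦ M / J M`, where `J` is the kernel of `π : R ⟶ S`. -/
def quotKerSMul (π : R →+* S) : FGModuleCat.{u} R ⥤ FGModuleCat.{u} R where
  obj M := FGModuleCat.of R (M.obj ⧸ (RingHom.ker π • (⊤ : Submodule R M.obj) : Submodule R M.obj))
  map {M N} f := FGModuleCat.ofHom (Submodule.mapQ _ _ f.hom.hom (by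
    intro x hx
    have := Submodule.mem_map_of_mem (f := f.hom.hom) hx
    rw [Submodule.map_smul''] at this
    exact Submodule.smul_mono le_rfl le_top this))
  map_id M := by
    ext x
    rfl
  map_comp f g := by
    ext x
    rfl

instance (π : R →+* S) : (kerSMul π).Additive where
  map_add := rfl

instance (π : R →+* S) : (quotKerSMul π).Additive where
  map_add := by
    intros
    ext x
    obtain ⟨x, rfl⟩ := Submodule.Quotient.mk_surjective _ x
    rfl

/-- The inclusion of `J M`, as a module over `S`, into `M`. -/
def kerSMulι : (kerSMul π ⋙ h.forgetful) ⋙ h.inflation ⟶ 𝟭 _ where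
  app M := ObjectProperty.homMk (ModuleCat.ofHom
    (X := (h.inflation.obj (h.forgetful.obj ((kerSMul π).obj M))).obj) (Y := M.obj)
    { toFun := fun x => x.1
      map_add' := fun _ _ => rfl
      map_smul' := fun r x =>
        smul_of_mem_ker_smul h.map_section h.mul_eq_zero r x.2 })
  naturality _ _ _ := rfl

/-- The projection from `M` to `M / J M`, as a module over `S`. -/
def quotKerSMulπ : 𝟭 _ ⟶ (quotKerSMul π ⋙ h.forgetful) ⋙ h.inflation where
  app M := ObjectProperty.homMk (ModuleCat.ofHom
    (X := M.obj) (Y := (h.inflation.obj (h.forgetful.obj ((quotKerSMul π).obj M))).obj)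
    { toFun := fun x => Submodule.Quotient.mk x
      map_add' := fun _ _ => rfl
      map_smul' := fun r x => by
        refine (Submodule.Quotient.eq _).2 ?_
        change r • x - σ (π r) • x ∈ _
        rw [← sub_smul]
        exact Submodule.smul_mem_smul (sub_mem_ker h.map_section r) trivial })
  naturality _ _ _ := rfl

lemma kerSMulι_comp_quotKerSMulπ : h.kerSMulι ≫ h.quotKerSMulπ = 0 := by
  ext M x
  exact (Submodule.Quotient.mk_eq_zero _).2 x.2

lemma shortExact [IsNoetherianRing S] (M : FGModuleCat.{u} R) :
    (ShortComplex.mk (h.kerSMulι.app M) (h.quotKerSMulπ.app M)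
      (NatTrans.congr_app h.kerSMulι_comp_quotKerSMulπ M)).ShortExact := by
  rw [shortExact_iff]
  refine ⟨fun x y hxy => Subtype.ext hxy, fun x => ?_, fun x => ?_⟩
  · obtain ⟨x, rfl⟩ := Submodule.Quotient.mk_surjective _ x
    exact ⟨x, rfl⟩
  · refine (Submodule.Quotient.mk_eq_zero _).trans ?_
    exact ⟨fun hx => ⟨⟨x, hx⟩, rfl⟩, fun ⟨y, hy⟩ => hy ▸ y.2⟩

lemma isExtension_ker [IsNoetherianRing S] :
    IsExtension (FGModuleCat.of R (RingHom.ker π)) (FGModuleCat.of R R)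
      (h.inflation.obj (FGModuleCat.of S S)) := by
  let g : FGModuleCat.of R R ⟶ h.inflation.obj (FGModuleCat.of S S) :=
    ObjectProperty.homMk (ModuleCat.ofHom (X := R)
      (Y := (h.inflation.obj (FGModuleCat.of S S)).obj)
      { toFun := π
        map_add' := π.map_add
        map_smul' := π.map_mul })
  let T := ShortComplex.mk (FGModuleCat.ofHom (RingHom.ker π).subtype) g (by
    ext x
    exact x.2)
  refine ((shortExact_iff T).2 ⟨Subtype.val_injective, h.surjective, fun x => ?_⟩).isExtension
  exact ⟨fun hx => ⟨⟨x, hx⟩, rfl⟩, fun ⟨y, hy⟩ => hy ▸ y.2⟩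

/-- The kernel `J` is a summand of `R ^ n`. As `J² = 0`, the projection `R ^ n ⟶ J` depends only on
coordinates modulo `J`, so the splitting passes through `S ^ n`. -/
lemma addClosure_inflation_ker :
    addClosure (.singleton (h.inflation.obj (FGModuleCat.of S S)))
      (FGModuleCat.of R (RingHom.ker π)) := by
  have := h.projective
  obtain ⟨n, g, hg⟩ := Module.Finite.exists_fin' R (RingHom.ker π)
  obtain ⟨s, hs⟩ := Module.projective_lifting_property g LinearMap.id hg
  have key : ∀ (r : R) (y : RingHom.ker π), σ (π r) • y = r • y := fun r y => by
    have := h.mul_eq_zero _ _ (sub_mem_ker h.map_section r) y.2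
    rw [sub_mul, sub_eq_zero] at this
    exact Subtype.ext this.symm
  let p : Fin n → RingHom.ker π →ₗ[R] (h.inflation.obj (FGModuleCat.of S S)).obj := fun i =>
    { toFun := fun x => π (s x i)
      map_add' := fun x y => by
        rw [map_add]
        exact π.map_add _ _
      map_smul' := fun r x => by
        rw [map_smul]
        exact π.map_mul _ _ }
  let q : Fin n → (h.inflation.obj (FGModuleCat.of S S)).obj →ₗ[R] RingHom.ker π := fun i =>
    { toFun := fun t => σ (show S from t) • g (Pi.single i 1)
      map_add' := fun t t' => by
        rw [← add_smul, ← map_add]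
        rfl
      map_smul' := fun r t => by
        change σ (π r * (show S from t)) • _ = r • σ (show S from t) • _
        rw [map_mul, mul_smul, key] }
  refine addClosure_of_fintype (fun _ : Fin n => h.inflation.obj (FGModuleCat.of S S))
    (fun i => ObjectProperty.homMk (ModuleCat.ofHom (X := RingHom.ker π)
      (Y := (h.inflation.obj (FGModuleCat.of S S)).obj) (p i)))
    (fun i => ObjectProperty.homMk (ModuleCat.ofHom
      (X := (h.inflation.obj (FGModuleCat.of S S)).obj) (Y := RingHom.ker π) (q i)))
    (fun _ => (ObjectProperty.singleton_iff _ _).2 rfl) ?_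
  refine FGModuleCat.hom_ext (LinearMap.ext fun x => ?_)
  rw [hom_hom_sum_apply]
  change ∑ i, σ (π (s x i)) • g (Pi.single i 1) = x
  calc _ = ∑ i, s x i • g (Pi.single i 1) := Finset.sum_congr rfl fun i _ => key _ _
    _ = g (s x) := by
      simp only [← map_smul, ← map_sum]
      congr 1
      ext j
      simp [Finset.sum_apply, Pi.single_apply]
    _ = x := LinearMap.congr_fun hs x

/-- Restricted along the section, `R` is an extension of `S` by `J`, and `J` is a summand of a power
of `S`; so `R` restricts to a projective module, and with it everything in `add R`. -/
lemma projective_forgetful [IsNoetherianRing S] (P : FGModuleCat.{u} R) (hP : Projective P) :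
    Projective (h.forgetful.obj P) := by
  have hS : Projective (h.forgetful.obj (h.inflation.obj (FGModuleCat.of S S))) :=
    Projective.of_iso (h.inflationCompForgetful.app (FGModuleCat.of S S)).symm inferInstance
  have hJ : Projective (h.forgetful.obj (FGModuleCat.of R (RingHom.ker π))) :=
    addClosure_singleton_le isAddClosed_projective hS _ (addClosure_map h.forgetful
      (singleton_map h.forgetful _) h.addClosure_inflation_ker)
  have hR : Projective (h.forgetful.obj (FGModuleCat.of R R)) := by
    obtain ⟨f, g, w, hex⟩ := h.isExtension_ker.map h.forgetful
    have hS' : Projective (ShortComplex.mk f g w).X₃ := hS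
    exact isAddClosed_projective.iso
      (hex.splittingOfProjective).isoBinaryBiproduct.symm (isAddClosed_projective.biprod hJ hS)
  exact addClosure_singleton_le isAddClosed_projective hR _ (addClosure_map h.forgetful
    (singleton_map h.forgetful _) (isProjectiveAddGenerator_self.2 P hP))

/-- For `P = S` the sequence `0 → J → R → S → 0` has `J` and `R` projective. The general case
follows because `P` lies in `add S`. -/
lemma exists_projective_isSyzygy_inflation [IsNoetherianRing S] (P : FGModuleCat.{u} S)
    (hP : Projective P) : ∃ Q, Projective Q ∧ IsSyzygy (h.inflation.obj P) 1 Q := by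
  obtain ⟨W, hW⟩ := exists_isSyzygy_one (h.inflation.obj P)
  refine ⟨W, IsSyzygy.prop_of_addClosure isAddClosed_projective (fun _ h => h) ?_
    (addClosure_map h.inflation (singleton_map h.inflation _)
      (isProjectiveAddGenerator_self.2 P hP)) hW, hW⟩
  intro X hX
  obtain rfl := (ObjectProperty.singleton_iff _ _).1 hX
  have := h.projective
  exact ⟨_, (isSyzygy_one_iff _ _).2 ⟨_, h.isExtension_ker, inferInstance⟩, projective_of _⟩

lemma exists_isExtension_inflation [IsNoetherianRing S] (A : FGModuleCat.{u} R) :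
    ∃ B B' : FGModuleCat.{u} S, IsExtension (h.inflation.obj B) A (h.inflation.obj B') :=
  ⟨_, _, (h.shortExact A).isExtension⟩

variable [IsNoetherianRing S]

include h

theorem igusaTodorovDistance_le :
    igusaTodorovDistance (FGModuleCat.{u} S) ≤ igusaTodorovDistance (FGModuleCat.{u} R) :=
  iInf_le_iInf_of_imp fun _ ⟨n, hn⟩ => ⟨n, isIgusaTodorovCategory_of_section h.inflation h.forgetful
    h.inflationCompForgetful h.projective_forgetful hn⟩

theorem igusaTodorovDistance_le_two_mul :
    igusaTodorovDistance (FGModuleCat.{u} R) ≤ 2 * igusaTodorovDistance (FGModuleCat.{u} S) + 1 :=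
  iInf_le_two_mul_iInf_add_one fun _ ⟨n, hn⟩ => ⟨n + 1, isIgusaTodorovCategory_of_isExtension
    isProjectiveAddGenerator_self h.inflation h.exists_projective_isSyzygy_inflation
    h.exists_isExtension_inflation hn⟩

theorem extensionDimension_le :
    extensionDimension (FGModuleCat.{u} S) ≤ extensionDimension (FGModuleCat.{u} R) :=
  iInf_le_iInf_of_imp fun _ ⟨_, hT⟩ => ⟨_, extensionLayer_eq_top_of_section h.inflation h.forgetful
    h.inflationCompForgetful hT⟩

theorem extensionDimension_le_two_mul :
    extensionDimension (FGModuleCat.{u} R) ≤ 2 * extensionDimension (FGModuleCat.{u} S) + 1 :=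
  iInf_le_two_mul_iInf_add_one fun _ ⟨_, hT⟩ => ⟨_, extensionLayer_eq_top_of_isExtension
    h.inflation h.exists_isExtension_inflation hT⟩

theorem boundedDerivedDimension_le :
    boundedDerivedDimension (FGModuleCat.{u} S) ≤ boundedDerivedDimension (FGModuleCat.{u} R) := by
  let _ : HasDerivedCategory.{u + 1} (FGModuleCat.{u} R) := HasDerivedCategory.standard _
  let _ : HasDerivedCategory.{u + 1} (FGModuleCat.{u} S) := HasDerivedCategory.standard _
  have := essSurj_mapBoundedDerivedCategory h.forgetful h.inflation h.inflationCompForgetful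
  exact iInf_le_iInf_of_imp fun _ ⟨_, hT⟩ =>
    ⟨_, triangEnvelopeIter_eq_top_of_essSurj h.forgetful.mapBoundedDerivedCategory hT⟩

theorem boundedDerivedDimension_le_two_mul :
    boundedDerivedDimension (FGModuleCat.{u} R) ≤
      2 * boundedDerivedDimension (FGModuleCat.{u} S) + 1 := by
  let _ : HasDerivedCategory.{u + 1} (FGModuleCat.{u} R) := HasDerivedCategory.standard _
  let _ : HasDerivedCategory.{u + 1} (FGModuleCat.{u} S) := HasDerivedCategory.standard _
  exact iInf_le_two_mul_iInf_add_one fun _ ⟨_, hT⟩ =>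
    ⟨_, triangEnvelopeIter_eq_top_of_triangle h.inflation.mapBoundedDerivedCategory
      (exists_distinguished_mapBoundedDerivedCategory h.inflation
        (kerSMul π ⋙ h.forgetful) (quotKerSMul π ⋙ h.forgetful) h.kerSMulι h.quotKerSMulπ
        h.kerSMulι_comp_quotKerSMulπ h.shortExact) hT⟩

end IsCleftExtension

end FGModuleCat

/-! ### Representations of quivers and the universal property of the path algebra -/

namespace PathAlgebra

variable {k : Type u} [Field k] {V : Type v} [Quiver.{w} V]

/-- A representation of a quiver with finitely many vertices in an algebra `B`: a complete system
of orthogonal idempotents indexed by the vertices, and an element for every arrow. -/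
structure QuiverRep [Fintype V] (B : Type*) [Ring B] where
  /-- The idempotent of a vertex. -/
  vertex : V → B
  /-- The element of an arrow. -/
  edge : ∀ {a b : V}, (a ⟶ b) → B
  vertex_mul_self : ∀ a, vertex a * vertex a = vertex a
  vertex_mul_vertex : ∀ a b, a ≠ b → vertex a * vertex b = 0
  sum_vertex : ∑ a, vertex a = 1
  vertex_mul_edge : ∀ {a b : V} (α : a ⟶ b), vertex a * edge α = edge α
  edge_mul_vertex : ∀ {a b : V} (α : a ⟶ b), edge α * vertex b = edge α

namespace QuiverRep

variable [Fintype V] {B : Type*} [Ring B] (F : QuiverRep (V := V) B)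

/-- The product of the elements of the arrows of a path. -/
def evalPath {a : V} : ∀ {b : V}, Quiver.Path a b → B
  | _, .nil => F.vertex a
  | _, .cons p α => evalPath p * F.edge α

lemma vertex_mul_evalPath {a b : V} (p : Quiver.Path a b) :
    F.vertex a * F.evalPath p = F.evalPath p := by
  induction p with
  | nil => exact F.vertex_mul_self a
  | cons p α ih => rw [evalPath, ← mul_assoc, ih]

lemma evalPath_mul_vertex {a b : V} (p : Quiver.Path a b) :
    F.evalPath p * F.vertex b = F.evalPath p := by
  cases p with
  | nil => exact F.vertex_mul_self a
  | cons p α => rw [evalPath, mul_assoc, F.edge_mul_vertex]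

lemma evalPath_comp {a b c : V} (p : Quiver.Path a b) (q : Quiver.Path b c) :
    F.evalPath (p.comp q) = F.evalPath p * F.evalPath q := by
  induction q with
  | nil => exact (F.evalPath_mul_vertex p).symm
  | cons q α ih => rw [Quiver.Path.comp_cons, evalPath, evalPath, ih, mul_assoc]

lemma evalPath_mul_of_ne {a b b' c : V} (p : Quiver.Path a b) (q : Quiver.Path b' c)
    (h : b ≠ b') : F.evalPath p * F.evalPath q = 0 := by
  rw [← F.evalPath_mul_vertex, ← F.vertex_mul_evalPath q, mul_assoc, ← mul_assoc (F.vertex b),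
    F.vertex_mul_vertex _ _ h, zero_mul, mul_zero]

variable [Algebra k B]

variable (k) in
/-- The linear map underlying `QuiverRep.lift`. -/
def liftLinear : PathAlgebra k V →ₗ[k] B :=
  Finsupp.linearCombination k fun p : QuiverPath V => F.evalPath p.2.2

lemma liftLinear_ofPath (p : QuiverPath V) : F.liftLinear k (ofPath k p) = F.evalPath p.2.2 := by
  unfold liftLinear ofPath
  erw [Finsupp.linearCombination_single, one_smul]

lemma liftLinear_mul (x y : PathAlgebra k V) :
    F.liftLinear k (x * y) = F.liftLinear k x * F.liftLinear k y := by
  induction x using induction_paths with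
  | h0 => simp only [zero_mul, map_zero]
  | hadd x x' h h' => simp only [add_mul, map_add, h, h']
  | hs s p =>
    induction y using induction_paths with
    | h0 => simp only [mul_zero, map_zero]
    | hadd x x' h h' => simp only [mul_add, map_add, h, h']
    | hs s' q =>
      simp only [smul_mul_assoc, mul_smul_comm, map_smul, liftLinear_ofPath]
      congr 2
      obtain ⟨a, b, p⟩ := p
      obtain ⟨b', c, q⟩ := q
      by_cases h : b = b'
      · subst h
        rw [ofPath_mul_of_eq, liftLinear_ofPath, F.evalPath_comp]
      · rw [ofPath_mul_of_ne _ _ h, map_zero, F.evalPath_mul_of_ne _ _ h]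

variable (k) in
/-- The universal property of the path algebra. -/
def lift : PathAlgebra k V →ₐ[k] B :=
  AlgHom.ofLinearMap (F.liftLinear k) (by
    rw [one_eq, map_sum, ← F.sum_vertex]
    exact Finset.sum_congr rfl fun a _ => F.liftLinear_ofPath _) F.liftLinear_mul

lemma lift_ofPath (p : QuiverPath V) : F.lift k (ofPath k p) = F.evalPath p.2.2 :=
  F.liftLinear_ofPath p

lemma lift_idem (a : V) : F.lift k (idem k a) = F.vertex a :=
  F.lift_ofPath _

lemma lift_arrow (α : Quiver.Total V) : F.lift k (arrow k α) = F.edge α.hom := by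
  refine (F.lift_ofPath _).trans ?_
  exact F.vertex_mul_edge α.hom

lemma lift_ofPath_eq_of_not_occursIn {A : Set (Quiver.Total V)} (g : PathAlgebra k V →ₐ[k] B)
    (hv : ∀ a, g (idem k a) = F.vertex a) (he : ∀ α ∉ A, g (arrow k α) = F.edge α.hom)
    {a b : V} (p : Quiver.Path a b) (hp : ∀ α ∈ A, ¬ OccursIn α ⟨a, b, p⟩) :
    F.lift k (ofPath k ⟨a, b, p⟩) = g (ofPath k ⟨a, b, p⟩) := by
  induction p with
  | nil => exact (F.lift_idem a).trans (hv a).symm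
  | @cons b c p α ih =>
    have h₁ := ih fun β hβ ⟨p₁, p₂, h⟩ => hp β hβ ⟨p₁, p₂.cons α, congrArg (·.cons α) h⟩
    have h₂ : (⟨b, c, α⟩ : Quiver.Total V) ∉ A := fun h => hp _ h ⟨p, .nil, rfl⟩
    have h₃ : ofPath k ⟨a, c, p.cons α⟩ = ofPath k ⟨a, b, p⟩ * arrow k ⟨b, c, α⟩ := by
      rw [arrow, ofPath_mul_of_eq]
      rfl
    rw [h₃, map_mul, map_mul, h₁, he _ h₂, lift_arrow]

lemma lift_eq_of_not_occursIn {A : Set (Quiver.Total V)} (g : PathAlgebra k V →ₐ[k] B)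
    (hv : ∀ a, g (idem k a) = F.vertex a) (he : ∀ α ∉ A, g (arrow k α) = F.edge α.hom)
    (x : PathAlgebra k V) (hx : ∀ p ∈ paths x, ∀ α ∈ A, ¬ OccursIn α p) :
    F.lift k x = g x := by
  have hsum : x = ∑ p ∈ paths x, (Finsupp.toFun x p : k) • ofPath k p := by
    conv_lhs => rw [← Finsupp.sum_single (M := k) x]
    refine Finset.sum_congr rfl fun p _ => ?_
    exact (Finsupp.smul_single_one p _).symm
  rw [hsum, map_sum, map_sum]
  refine Finset.sum_congr rfl fun p hp => ?_
  rw [map_smul, map_smul, F.lift_ofPath_eq_of_not_occursIn g hv he _ (hx p hp)]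

end QuiverRep

/-- The two-sided ideal `I` is generated by linear combinations of paths that avoid `A`. -/
def IsGeneratedAvoiding [Fintype V] (I : TwoSidedIdeal (PathAlgebra k V))
    (A : Set (Quiver.Total V)) : Prop :=
  ∃ S : Set (PathAlgebra k V), TwoSidedIdeal.span S = I ∧
    ∀ r ∈ S, ∀ p ∈ paths r, ∀ α ∈ A, ¬ OccursIn α p

namespace QuiverRep

variable [Fintype V] {B : Type*} [Ring B] [Algebra k B] (F : QuiverRep (V := V) B)
  {I : TwoSidedIdeal (PathAlgebra k V)} {A : Set (Quiver.Total V)}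

/-- The descent of `QuiverRep.lift` to a quotient of the path algebra by an ideal whose generators
avoid `A`, given a homomorphism out of the quotient with the same values at the vertices and at
the arrows outside of `A`. -/
def descend (hI : IsGeneratedAvoiding I A) (g : BoundAlgebra I →ₐ[k] B)
    (hv : ∀ a, g (vertexIdem I a) = F.vertex a)
    (he : ∀ α ∉ A, g (Ideal.Quotient.mk _ (arrow k α)) = F.edge α.hom) :
    BoundAlgebra I →ₐ[k] B :=
  Ideal.Quotient.liftₐ I.asIdeal (F.lift k) (by
    obtain ⟨S, rfl, hS⟩ := hI
    intro x hx
    rw [TwoSidedIdeal.mem_asIdeal] at hx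
    have : TwoSidedIdeal.span S ≤ TwoSidedIdeal.ker (F.lift k) := by
      refine TwoSidedIdeal.span_le.2 fun r hr => (TwoSidedIdeal.mem_ker _).2 ?_
      -- On a generator only arrows outside `A` occur, so the lift agrees there with `g` composed
      -- with the quotient map, which kills `I`. The values at the arrows in `A` are thus free.
      rw [F.lift_eq_of_not_occursIn (g.comp (Ideal.Quotient.mkₐ k _)) hv he r (hS r hr)]
      have : Ideal.Quotient.mkₐ k (TwoSidedIdeal.span S).asIdeal r = 0 :=
        Ideal.Quotient.eq_zero_iff_mem.2
          ((TwoSidedIdeal.mem_asIdeal).2 (TwoSidedIdeal.subset_span hr))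
      rw [AlgHom.comp_apply, this, map_zero]
    exact (TwoSidedIdeal.mem_ker _).1 (this hx))

end QuiverRep

section BoundAlgebra

variable [Fintype V] (I : TwoSidedIdeal (PathAlgebra k V))

/-- The residue class of an arrow. -/
def arrowClass (α : Quiver.Total V) : BoundAlgebra I :=
  Ideal.Quotient.mk I.asIdeal (arrow k α)

lemma vertexIdem_mul_self (a : V) : vertexIdem I a * vertexIdem I a = vertexIdem I a := by
  rw [vertexIdem, ← map_mul, idem, ofPath_mul_of_eq]
  rfl

lemma vertexIdem_mul_vertexIdem (a b : V) (h : a ≠ b) : vertexIdem I a * vertexIdem I b = 0 := by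
  rw [vertexIdem, vertexIdem, ← map_mul, idem, idem, ofPath_mul_of_ne _ _ h, map_zero]

lemma sum_vertexIdem : ∑ a, vertexIdem I a = 1 := by
  rw [← map_one (Ideal.Quotient.mk I.asIdeal), one_eq, map_sum]
  rfl

lemma vertexIdem_mul_arrowClass (α : Quiver.Total V) :
    vertexIdem I α.left * arrowClass I α = arrowClass I α := by
  rw [vertexIdem, arrowClass, ← map_mul, idem, arrow, ofPath_mul_of_eq, Quiver.Path.nil_comp]

lemma arrowClass_mul_vertexIdem (α : Quiver.Total V) :
    arrowClass I α * vertexIdem I α.right = arrowClass I α := by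
  rw [vertexIdem, arrowClass, ← map_mul, idem, arrow, ofPath_mul_of_eq, Quiver.Path.comp_nil]

end BoundAlgebra

end PathAlgebra

/-! ### Splitting off the removed arrows -/

namespace PathAlgebra

variable {k : Type u} [Field k] {V : Type v} [Quiver.{w} V] [Fintype V]
  {I : TwoSidedIdeal (PathAlgebra k V)}

-- Paths are built by appending arrows on the right, which fits right actions: an element acts
-- through its arrows from first to last.
@[elab_as_elim]
lemma boundAlgebra_induction {motive : BoundAlgebra I → Prop} (zero : motive 0)
    (add : ∀ x y, motive x → motive y → motive (x + y))
    (smul : ∀ (r : k) x, motive x → motive (r • x)) (vertex : ∀ a, motive (vertexIdem I a))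
    (mul_arrow : ∀ x α, motive x → motive (x * arrowClass I α)) (x : BoundAlgebra I) :
    motive x := by
  obtain ⟨x, rfl⟩ := Ideal.Quotient.mk_surjective x
  induction x using induction_paths with
  | h0 => rwa [map_zero]
  | hadd x y hx hy => rw [map_add]; exact add _ _ hx hy
  | hs r p =>
    refine smul r (Ideal.Quotient.mk _ (ofPath k p)) ?_
    obtain ⟨a, b, p⟩ := p
    induction p with
    | nil => exact vertex a
    | @cons b c p α ih =>
      have h₃ : ofPath k ⟨a, c, p.cons α⟩ = ofPath k ⟨a, b, p⟩ * arrow k ⟨b, c, α⟩ := by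
        rw [arrow, ofPath_mul_of_eq]
        rfl
      rw [h₃, map_mul]
      exact mul_arrow _ _ ih

section RightMul

variable (k : Type u) [Field k] {B : Type w} [Ring B] [Algebra k B]

/-- Right multiplication on `B × B`. -/
def rightMul : B →ₐ[k] (Module.End k (B × B))ᵐᵒᵖ :=
  AlgHom.opComm.symm (Algebra.lsmul k k (B × B))

variable {k}

/-- The endomorphism `(x, y) ↦ (0, ξ (x e) f)` of `B × B`. -/
def twist (ξ : B →ₗ[k] k) (e f : B) : Module.End k (B × B) where
  toFun y := (0, ξ (y.1 * e) • f)
  map_add' x y := by simp [add_mul, add_smul]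
  map_smul' r x := by simp [mul_smul]

lemma twist_apply (ξ : B →ₗ[k] k) (e f : B) (y : B × B) :
    twist ξ e f y = (0, ξ (y.1 * e) • f) := rfl

lemma rightMul_mul_op_twist (ξ : B →ₗ[k] k) {e f : B} (he : e * e = e) :
    rightMul k e * .op (twist ξ e f) = .op (twist ξ e f) :=
  MulOpposite.unop_injective (LinearMap.ext fun y => by
    change twist ξ e f (y.1 * e, _) = _
    rw [twist_apply]
    change (0, ξ (y.1 * e * e) • f) = _
    rw [mul_assoc, he]
    rfl)

lemma op_twist_mul_rightMul (ξ : B →ₗ[k] k) {e f : B} (hf : f * f = f) :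
    .op (twist ξ e f) * rightMul k f = .op (twist ξ e f) :=
  MulOpposite.unop_injective (LinearMap.ext fun y => by
    change ((0 : B) * f, (ξ (y.1 * e) • f) * f) = _
    rw [zero_mul, smul_mul_assoc, hf]
    rfl)

end RightMul

section Retraction

variable {A : Set (Quiver.Total V)}

variable (I A) in
open Classical in
/-- The representation of the quiver in `kQ/I` that sends the arrows in `A` to zero. -/
def retractionRep : QuiverRep (V := V) (BoundAlgebra I) where
  vertex := vertexIdem I
  edge {a b} α := if (⟨a, b, α⟩ : Quiver.Total V) ∈ A then 0 else arrowClass I ⟨a, b, α⟩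
  vertex_mul_self := vertexIdem_mul_self I
  vertex_mul_vertex := vertexIdem_mul_vertexIdem I
  sum_vertex := sum_vertexIdem I
  vertex_mul_edge {a b} α := by
    split_ifs
    · exact mul_zero _
    · exact vertexIdem_mul_arrowClass I ⟨a, b, α⟩
  edge_mul_vertex {a b} α := by
    split_ifs
    · exact zero_mul _
    · exact arrowClass_mul_vertexIdem I ⟨a, b, α⟩

variable (hI : IsGeneratedAvoiding I A)

/-- The endomorphism of `kQ/I` that sends the arrows in `A` to zero and fixes the vertices and the
other arrows. -/
def retraction : BoundAlgebra I →ₐ[k] BoundAlgebra I :=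
  (retractionRep I A).descend hI (AlgHom.id _ _) (fun _ => rfl) fun _ hα => (if_neg hα).symm

lemma retraction_vertexIdem (a : V) : retraction hI (vertexIdem I a) = vertexIdem I a :=
  QuiverRep.lift_idem _ _

lemma retraction_arrowClass_of_mem {α : Quiver.Total V} (hα : α ∈ A) :
    retraction hI (arrowClass I α) = 0 :=
  (QuiverRep.lift_arrow _ _).trans (if_pos hα)

lemma retraction_arrowClass_of_notMem {α : Quiver.Total V} (hα : α ∉ A) :
    retraction hI (arrowClass I α) = arrowClass I α :=
  (QuiverRep.lift_arrow _ _).trans (if_neg hα)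

end Retraction

variable {ι : Type*} {a : ι → Quiver.Total V} (hI : IsGeneratedAvoiding I (Set.range a))

lemma arrowClass_mem_removedIdeal {α : Quiver.Total V} (hα : α ∈ Set.range a) :
    arrowClass I α ∈ removedIdeal I a := by
  obtain ⟨i, rfl⟩ := hα
  exact TwoSidedIdeal.subset_span ⟨i, rfl⟩

lemma retraction_eq_zero {x : BoundAlgebra I} (hx : x ∈ removedIdeal I a) :
    retraction hI x = 0 := by
  have : removedIdeal I a ≤ TwoSidedIdeal.ker (retraction hI) := by
    refine TwoSidedIdeal.span_le.2 ?_
    rintro _ ⟨i, rfl⟩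
    exact (TwoSidedIdeal.mem_ker _).2 (retraction_arrowClass_of_mem hI ⟨i, rfl⟩)
  exact (TwoSidedIdeal.mem_ker _).1 (this hx)

/-- The retraction changes only the removed arrows, so it is the identity modulo the removed ideal.
This makes `removalSection` a section of the quotient map. -/
lemma sub_retraction_mem (x : BoundAlgebra I) : x - retraction hI x ∈ removedIdeal I a := by
  induction x using boundAlgebra_induction with
  | zero => rw [map_zero, sub_zero]; exact zero_mem _
  | add x y hx hy => rw [map_add, add_sub_add_comm]; exact add_mem hx hy
  | smul r x hx =>
    rw [map_smul, ← smul_sub, Algebra.smul_def]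
    exact TwoSidedIdeal.mul_mem_left _ _ _ hx
  | vertex a => rw [retraction_vertexIdem, sub_self]; exact zero_mem _
  | mul_arrow x α hx =>
    rw [map_mul]
    by_cases hα : α ∈ Set.range a
    · rw [retraction_arrowClass_of_mem hI hα, mul_zero, sub_zero]
      exact TwoSidedIdeal.mul_mem_left _ _ _ (arrowClass_mem_removedIdeal hα)
    · rw [retraction_arrowClass_of_notMem hI hα, ← sub_mul]
      exact TwoSidedIdeal.mul_mem_right _ _ _ hx

/-- The section of `Λ ⟶ Γ` that sends the classes of the remaining vertices and arrows to
themselves. -/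
def removalSection : ArrowRemoval I a →+* BoundAlgebra I :=
  Ideal.Quotient.lift _ (retraction hI : BoundAlgebra I →+* BoundAlgebra I) fun _ hx =>
    retraction_eq_zero hI (TwoSidedIdeal.mem_asIdeal.1 hx)

lemma mk_removalSection (x : ArrowRemoval I a) :
    Ideal.Quotient.mk (removedIdeal I a).asIdeal (removalSection hI x) = x := by
  obtain ⟨x, rfl⟩ := Ideal.Quotient.mk_surjective x
  refine (Ideal.Quotient.eq.2 ?_).symm
  exact TwoSidedIdeal.mem_asIdeal.2 (sub_retraction_mem hI x)

lemma mem_ker_op_mk {x : (BoundAlgebra I)ᵐᵒᵖ} :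
    x ∈ RingHom.ker (RingHom.op (Ideal.Quotient.mk (removedIdeal I a).asIdeal)) ↔
      x.unop ∈ removedIdeal I a := by
  rw [RingHom.mem_ker, ← TwoSidedIdeal.mem_asIdeal, ← Ideal.Quotient.eq_zero_iff_mem]
  exact MulOpposite.unop_injective.eq_iff.symm

/-! ### The removed ideal has square zero -/

section SquareZero

variable (hA : ∀ α ∈ Set.range a, ∀ β ∈ Set.range a, ∀ x : BoundAlgebra I,
  vertexIdem I β.right * x * vertexIdem I α.left = 0)

include hA

lemma vertexIdem_mul_of_mem_removedIdeal {β : Quiver.Total V} (hβ : β ∈ Set.range a)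
    {x : BoundAlgebra I} (hx : x ∈ removedIdeal I a) : vertexIdem I β.right * x = 0 := by
  -- The inserted factor `z` makes the claim stable under multiplying `x` on the left; for a
  -- generator it is `hA`, since the arrow absorbs the idempotent of its source.
  have : ∀ z, vertexIdem I β.right * z * x = 0 := by
    induction hx using TwoSidedIdeal.span_induction with
    | mem x hx =>
      obtain ⟨i, rfl⟩ := hx
      intro z
      have := congrArg (· * arrowClass I (a i)) (hA _ ⟨i, rfl⟩ _ hβ z)
      simp only [zero_mul] at this
      rwa [mul_assoc, vertexIdem_mul_arrowClass] at this
    | zero => exact fun z => mul_zero _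
    | add x y _ _ hx hy => exact fun z => by rw [mul_add, hx, hy, add_zero]
    | neg x _ hx => exact fun z => by rw [mul_neg, hx, neg_zero]
    | left_absorb r x _ hx => exact fun z => by rw [← mul_assoc, mul_assoc _ z, hx]
    | right_absorb r x _ hx => exact fun z => by rw [← mul_assoc, hx, zero_mul]
  simpa using this 1

lemma mul_eq_zero_of_mem_removedIdeal {x y : BoundAlgebra I} (hx : x ∈ removedIdeal I a)
    (hy : y ∈ removedIdeal I a) : x * y = 0 := by
  induction hx using TwoSidedIdeal.span_induction generalizing y with
  | mem x hx =>
    obtain ⟨i, rfl⟩ := hx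
    change arrowClass I (a i) * y = 0
    rw [← arrowClass_mul_vertexIdem, mul_assoc,
      vertexIdem_mul_of_mem_removedIdeal hA ⟨i, rfl⟩ hy, mul_zero]
  | zero => exact zero_mul _
  | add x x' _ _ hx hx' => rw [add_mul, hx hy, hx' hy, add_zero]
  | neg x _ hx => rw [neg_mul, hx hy, neg_zero]
  | left_absorb r x _ hx => rw [mul_assoc, hx hy, mul_zero]
  | right_absorb r x _ hx => rw [mul_assoc, hx (TwoSidedIdeal.mul_mem_left _ _ _ hy)]

end SquareZero

/-! ### Coordinates on the removed ideal and its projectivity -/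

section Derivation

/-- `twist` for the idempotents of the source and the target of an arrow. -/
abbrev arrowTwist (α : Quiver.Total V) (ξ : BoundAlgebra I →ₗ[k] k) :
    Module.End k (BoundAlgebra I × BoundAlgebra I) :=
  twist ξ (vertexIdem I α.left) (vertexIdem I α.right)

open Classical in
/-- The representation on `Λ × Λ` in which the arrows outside of `A` act by right multiplication
and the arrows in `A` other than `α₀` by zero, while `α₀` acts by `arrowTwist α₀ ξ`. -/
def twistRep (A : Set (Quiver.Total V)) (α₀ : Quiver.Total V) (ξ : BoundAlgebra I →ₗ[k] k) :
    QuiverRep (V := V) (Module.End k (BoundAlgebra I × BoundAlgebra I))ᵐᵒᵖ where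
  vertex a := rightMul k (vertexIdem I a)
  edge {a b} α := rightMul k ((retractionRep I A).edge α) +
    if (⟨a, b, α⟩ : Quiver.Total V) = α₀ then .op (arrowTwist α₀ ξ) else 0
  vertex_mul_self a := by rw [← map_mul, vertexIdem_mul_self]
  vertex_mul_vertex a b h := by rw [← map_mul, vertexIdem_mul_vertexIdem I a b h, map_zero]
  sum_vertex := by rw [← map_sum, sum_vertexIdem, map_one]
  vertex_mul_edge {a b} α := by
    rw [mul_add, ← map_mul]
    refine congrArg₂ (· + ·)
      (congrArg (rightMul k) ((retractionRep I A).vertex_mul_edge α)) ?_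
    split_ifs with hα
    · subst hα
      exact rightMul_mul_op_twist ξ (vertexIdem_mul_self I a)
    · exact mul_zero _
  edge_mul_vertex {a b} α := by
    rw [add_mul, ← map_mul]
    refine congrArg₂ (· + ·)
      (congrArg (rightMul k) ((retractionRep I A).edge_mul_vertex α)) ?_
    split_ifs with hα
    · subst hα
      exact op_twist_mul_rightMul ξ (vertexIdem_mul_self I b)
    · exact zero_mul _

variable {α₀ : Quiver.Total V} (hα₀ : α₀ ∈ Set.range a) (ξ : BoundAlgebra I →ₗ[k] k)

/-- The action of `Λ` on `Λ × Λ` given by `twistRep`. -/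
def twistHom : BoundAlgebra I →ₐ[k] (Module.End k (BoundAlgebra I × BoundAlgebra I))ᵐᵒᵖ :=
  (twistRep (Set.range a) α₀ ξ).descend hI (rightMul k) (fun _ => rfl) fun α hα => by
    have h₁ : α ≠ α₀ := fun h => hα (h ▸ hα₀)
    have h₂ : (retractionRep I (Set.range a)).edge α.hom = arrowClass I α := if_neg hα
    refine Eq.trans ?_ (congrArg₂ (· + ·) (congrArg (rightMul k) h₂) (if_neg h₁)).symm
    exact (add_zero _).symm

lemma twistHom_vertexIdem (b : V) (y : BoundAlgebra I × BoundAlgebra I) :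
    (twistHom hI hα₀ ξ (vertexIdem I b)).unop y = (y.1 * vertexIdem I b, y.2 * vertexIdem I b) :=
  congrArg (fun f => f.unop y) (QuiverRep.lift_idem (twistRep (Set.range a) α₀ ξ) b)

open Classical in
lemma twistHom_arrowClass (α : Quiver.Total V) (y : BoundAlgebra I × BoundAlgebra I) :
    (twistHom hI hα₀ ξ (arrowClass I α)).unop y =
      (y.1 * retraction hI (arrowClass I α), y.2 * retraction hI (arrowClass I α)) +
        if α = α₀ then arrowTwist α₀ ξ y else 0 := by
  have h₁ := congrArg (fun f => f.unop y)
    (QuiverRep.lift_arrow (k := k) (twistRep (Set.range a) α₀ ξ) α)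
  have h₂ : retraction hI (arrowClass I α) = (retractionRep I (Set.range a)).edge α.hom :=
    QuiverRep.lift_arrow _ _
  rw [h₂]
  refine h₁.trans ?_
  change _ + (MulOpposite.unop (if α = α₀ then .op (arrowTwist α₀ ξ) else 0)) y = _
  split_ifs <;> rfl

lemma twistHom_mul (x x' : BoundAlgebra I) (y : BoundAlgebra I × BoundAlgebra I) :
    (twistHom hI hα₀ ξ (x * x')).unop y =
      (twistHom hI hα₀ ξ x').unop ((twistHom hI hα₀ ξ x).unop y) := by
  rw [map_mul]
  rfl

/-- The twist maps into `0 × Λ` and kills it, so the action is triangular and its diagonal entries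
are right multiplication by the retraction. The other diagonal entry is `twistHom_zero_mk`. -/
lemma twistHom_fst (x : BoundAlgebra I) (y : BoundAlgebra I × BoundAlgebra I) :
    ((twistHom hI hα₀ ξ x).unop y).1 = y.1 * retraction hI x := by
  induction x using boundAlgebra_induction generalizing y with
  | zero => rw [map_zero, map_zero, mul_zero]; rfl
  | add x x' hx hx' => rw [map_add, map_add, mul_add, ← hx, ← hx']; rfl
  | smul r x hx => rw [map_smul, map_smul, mul_smul_comm, ← hx]; rfl
  | vertex b => rw [twistHom_vertexIdem, retraction_vertexIdem]
  | mul_arrow x α hx =>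
    rw [twistHom_mul, twistHom_arrowClass, map_mul, ← mul_assoc, ← hx]
    split_ifs
    · exact add_zero _
    · rw [add_zero]

lemma twistHom_zero_mk (x y : BoundAlgebra I) :
    (twistHom hI hα₀ ξ x).unop (0, y) = (0, y * retraction hI x) := by
  induction x using boundAlgebra_induction with
  | zero => rw [map_zero, map_zero, mul_zero]; rfl
  | add x x' hx hx' =>
    rw [map_add, map_add, mul_add]
    refine (congrArg₂ (· + ·) hx hx').trans ?_
    simp
  | smul r x hx =>
    rw [map_smul, map_smul, mul_smul_comm]
    refine (congrArg (r • ·) hx).trans ?_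
    simp
  | vertex b => rw [twistHom_vertexIdem, retraction_vertexIdem, zero_mul]
  | mul_arrow x α hx =>
    rw [twistHom_mul, twistHom_arrowClass, map_mul, ← mul_assoc, hx]
    simp [twist]

lemma vertexIdem_mul_twistHom_snd (x : BoundAlgebra I) (y : BoundAlgebra I × BoundAlgebra I)
    (hy : vertexIdem I α₀.right * y.2 = y.2) :
    vertexIdem I α₀.right * ((twistHom hI hα₀ ξ x).unop y).2 =
      ((twistHom hI hα₀ ξ x).unop y).2 := by
  induction x using boundAlgebra_induction with
  | zero => rw [map_zero]; exact mul_zero _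
  | add x x' hx hx' =>
    rw [map_add]
    exact (mul_add _ _ _).trans (congrArg₂ (· + ·) hx hx')
  | smul r x hx =>
    rw [map_smul]
    exact (mul_smul_comm _ _ _).trans (congrArg (r • ·) hx)
  | vertex b => rw [twistHom_vertexIdem, ← mul_assoc, hy]
  | mul_arrow x α hx =>
    rw [twistHom_mul, twistHom_arrowClass, Prod.snd_add, mul_add, ← mul_assoc, hx]
    congr 1
    split_ifs
    · exact (mul_smul_comm _ _ _).trans (congrArg _ (vertexIdem_mul_self I _))
    · exact mul_zero _

/-- The linear map `Λ ⟶ Λ` that sends a path `p α₀ q` with exactly one arrow in `A` to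
`ξ(p) q`. -/
def coeffMap : BoundAlgebra I →ₗ[k] BoundAlgebra I where
  toFun x := ((twistHom hI hα₀ ξ x).unop (1, 0)).2
  map_add' x y := by rw [map_add]; rfl
  map_smul' r x := by rw [map_smul]; rfl

lemma twistHom_one_zero (x : BoundAlgebra I) :
    (twistHom hI hα₀ ξ x).unop (1, 0) = (retraction hI x, coeffMap hI hα₀ ξ x) :=
  Prod.ext ((twistHom_fst hI hα₀ ξ x _).trans (one_mul _)) rfl

/-- The retraction kills `x`, so `x` moves `(1, 0)` into `0 × Λ`, where `y` acts by its retraction.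
-/
lemma coeffMap_mul {x : BoundAlgebra I} (hx : x ∈ removedIdeal I a) (y : BoundAlgebra I) :
    coeffMap hI hα₀ ξ (x * y) = coeffMap hI hα₀ ξ x * retraction hI y := by
  have : (twistHom hI hα₀ ξ (x * y)).unop (1, 0) =
      (0, coeffMap hI hα₀ ξ x * retraction hI y) := by
    rw [twistHom_mul, twistHom_one_zero, retraction_eq_zero hI hx, twistHom_zero_mk]
  exact congrArg Prod.snd this

open Classical in
lemma coeffMap_mul_arrowClass (x : BoundAlgebra I) {α : Quiver.Total V} (hα : α ∈ Set.range a) :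
    coeffMap hI hα₀ ξ (x * arrowClass I α) =
      if α = α₀ then ξ (retraction hI x * vertexIdem I α₀.left) • vertexIdem I α₀.right
      else 0 := by
  have : (twistHom hI hα₀ ξ (x * arrowClass I α)).unop (1, 0) =
      if α = α₀ then arrowTwist α₀ ξ (retraction hI x, coeffMap hI hα₀ ξ x) else 0 := by
    rw [twistHom_mul, twistHom_one_zero, twistHom_arrowClass, retraction_arrowClass_of_mem hI hα,
      mul_zero, mul_zero]
    exact zero_add _
  refine (congrArg Prod.snd this).trans ?_
  split_ifs <;> rfl

lemma vertexIdem_mul_coeffMap (x : BoundAlgebra I) :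
    vertexIdem I α₀.right * coeffMap hI hα₀ ξ x = coeffMap hI hα₀ ξ x :=
  vertexIdem_mul_twistHom_snd hI hα₀ ξ x _ (mul_zero _)

variable (hA : ∀ α ∈ Set.range a, ∀ β ∈ Set.range a, ∀ x : BoundAlgebra I,
  vertexIdem I β.right * x * vertexIdem I α.left = 0)

include hA

/-- The values of `coeffMap` lie in `f Λ`, with `f` the idempotent at the target of `α₀`, and `f`
annihilates the removed ideal from the left. So `y` and its retraction act alike, and `coeffMap` is
right `Λ`-linear on the ideal. -/
lemma coeffMap_mul_of_mem {x : BoundAlgebra I} (hx : x ∈ removedIdeal I a) (y : BoundAlgebra I) :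
    coeffMap hI hα₀ ξ (x * y) = coeffMap hI hα₀ ξ x * y := by
  have h := vertexIdem_mul_of_mem_removedIdeal hA hα₀
    (TwoSidedIdeal.mul_mem_left _ (coeffMap hI hα₀ ξ x) _ (sub_retraction_mem hI y))
  rw [← mul_assoc, vertexIdem_mul_coeffMap, mul_sub, sub_eq_zero] at h
  rw [coeffMap_mul hI hα₀ ξ hx, h]

lemma retraction_mul_arrowClass_mul {α : Quiver.Total V} (hα : α ∈ Set.range a)
    (x y : BoundAlgebra I) :
    retraction hI x * arrowClass I α * retraction hI y = x * arrowClass I α * y := by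
  have hα' : arrowClass I α ∈ removedIdeal I a := arrowClass_mem_removedIdeal hα
  have h₁ := mul_eq_zero_of_mem_removedIdeal hA (sub_retraction_mem hI x) hα'
  have h₂ := mul_eq_zero_of_mem_removedIdeal hA (TwoSidedIdeal.mul_mem_left _ x _ hα')
    (sub_retraction_mem hI y)
  rw [sub_mul, sub_eq_zero] at h₁
  rw [mul_sub, sub_eq_zero] at h₂
  rw [← h₁, h₂]

/-- Dual basis identity. On `u α v` the coefficients return the coordinates of the retraction of `u`
(cut off at the source of `α`) times the retraction of `v`; summing restores `u α v`, since
retracting `u` and `v` costs only products of two elements of the ideal. The sum is over the range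
of `a` so that a repeated arrow counts once. -/
lemma sum_mul_coeffMap [Fintype (Set.range a)] {κ : Type*} [Fintype κ]
    (b : Module.Basis κ k (BoundAlgebra I)) {x : BoundAlgebra I} (hx : x ∈ removedIdeal I a) :
    ∑ α : Set.range a, ∑ j, b j * arrowClass I α * coeffMap hI α.2 (b.coord j) x = x := by
  classical
  rw [removedIdeal, TwoSidedIdeal.mem_span_iff_mem_addSubgroup_closure] at hx
  induction hx using AddSubgroup.closure_induction with
  | mem x hx =>
    obtain ⟨_, ⟨u, -, _, ⟨i, rfl⟩, rfl⟩, v, -, rfl⟩ := hx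
    change ∑ α : Set.range a, ∑ j, b j * arrowClass I α *
      coeffMap hI α.2 (b.coord j) (u * arrowClass I (a i) * v) = u * arrowClass I (a i) * v
    have hi : a i ∈ Set.range a := ⟨i, rfl⟩
    have hmem : u * arrowClass I (a i) ∈ removedIdeal I a :=
      TwoSidedIdeal.mul_mem_left _ _ _ (arrowClass_mem_removedIdeal hi)
    simp only [coeffMap_mul hI _ _ hmem, coeffMap_mul_arrowClass hI _ _ _ hi]
    rw [Finset.sum_eq_single ⟨a i, hi⟩]
    · simp only [if_true, Module.Basis.coord_apply, smul_mul_assoc, mul_smul_comm]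
      simp only [← smul_mul_assoc]
      rw [← Finset.sum_mul, ← Finset.sum_mul, b.sum_repr]
      rw [mul_assoc _ (vertexIdem I _) (arrowClass I _), vertexIdem_mul_arrowClass, ← mul_assoc,
        mul_assoc _ (arrowClass I _), arrowClass_mul_vertexIdem,
        retraction_mul_arrowClass_mul hI hA hi]
    · rintro ⟨α, hα⟩ - hne
      have : a i ≠ α := fun h => hne (Subtype.ext h.symm)
      simp only [if_neg this, zero_mul, mul_zero, Finset.sum_const_zero]
    · exact fun h => (h (Finset.mem_univ _)).elim
  | zero => simp
  | add x y _ _ hx hy =>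
    conv_rhs => rw [← hx, ← hy]
    simp only [map_add, mul_add, Finset.sum_add_distrib]
  | neg x _ hx =>
    conv_rhs => rw [← hx]
    simp only [map_neg, mul_neg, Finset.sum_neg_distrib]

include hI

/-- Taking coordinates (`i`) and expanding in the elements `b j * arrowClass I α` (`s`) exhibits the
ideal as a summand of a free module of finite rank. -/
lemma projective_removedIdeal [Finite ι] [Module.Finite k (BoundAlgebra I)] :
    Module.Projective (BoundAlgebra I)ᵐᵒᵖ
      (RingHom.ker (RingHom.op (Ideal.Quotient.mk (removedIdeal I a).asIdeal))) := by
  have : Fintype (Set.range a) := Fintype.ofFinite _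
  let b := Module.finBasis k (BoundAlgebra I)
  let i : RingHom.ker (RingHom.op (Ideal.Quotient.mk (removedIdeal I a).asIdeal))
      →ₗ[(BoundAlgebra I)ᵐᵒᵖ] (Set.range a → _ → (BoundAlgebra I)ᵐᵒᵖ) :=
    { toFun := fun x α j => .op (coeffMap hI α.2 (b.coord j) x.1.unop)
      map_add' := fun x y => by
        ext α j
        exact congrArg _ (map_add _ _ _)
      map_smul' := fun r x => by
        ext α j
        exact congrArg MulOpposite.op
          (coeffMap_mul_of_mem hI α.2 _ hA (mem_ker_op_mk.1 x.2) r.unop) }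
  let s : (Set.range a → _ → (BoundAlgebra I)ᵐᵒᵖ) →ₗ[(BoundAlgebra I)ᵐᵒᵖ]
      RingHom.ker (RingHom.op (Ideal.Quotient.mk (removedIdeal I a).asIdeal)) :=
    ∑ α : Set.range a, ∑ j,
      (LinearMap.toSpanSingleton (BoundAlgebra I)ᵐᵒᵖ _ ⟨.op (b j * arrowClass I α),
        mem_ker_op_mk.2 (TwoSidedIdeal.mul_mem_left _ _ _ (arrowClass_mem_removedIdeal α.2))⟩) ∘ₗ
        LinearMap.proj j ∘ₗ LinearMap.proj α
  refine Module.Projective.of_split i s (LinearMap.ext fun x => Subtype.ext ?_)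
  refine Eq.trans ?_ (congrArg MulOpposite.op (sum_mul_coeffMap hI hA b (mem_ker_op_mk.1 x.2)))
  simp only [s, LinearMap.comp_apply, LinearMap.sum_apply, AddSubmonoidClass.coe_finsetSum,
    Finset.op_sum]
  rfl

end Derivation

end PathAlgebra

/-! ### The hypotheses of the theorem give a cleft extension -/

namespace PathAlgebra

variable {k : Type u} [Field k] {V : Type v} [Quiver.{w} V] [Fintype V]
  {I : TwoSidedIdeal (PathAlgebra k V)}

/-- Left multiplication by `e_c x` is a homomorphism `e_b Λ → e_c Λ`; it is zero, and its value at
`e_b` is the product in question. -/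
lemma vertexIdem_mul_mul_vertexIdem_eq_zero {b c : V}
    (h : ∀ φ : vertexModule I b →ₗ[(BoundAlgebra I)ᵐᵒᵖ] vertexModule I c, φ = 0)
    (x : BoundAlgebra I) : vertexIdem I c * x * vertexIdem I b = 0 := by
  let φ : vertexModule I b →ₗ[(BoundAlgebra I)ᵐᵒᵖ] vertexModule I c :=
    (DistribSMul.toLinearMap (BoundAlgebra I)ᵐᵒᵖ (BoundAlgebra I) (vertexIdem I c * x)).restrict
      fun z _ => by
        change vertexIdem I c * x * z ∈ _
        rw [mul_assoc]
        exact Submodule.smul_mem _ (MulOpposite.op (x * z)) (Submodule.mem_span_singleton_self _)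
  exact congrArg Subtype.val (LinearMap.congr_fun (h φ)
    ⟨vertexIdem I b, Submodule.mem_span_singleton_self _⟩)

lemma isCleftExtension_removalSection {ι : Type*} [Finite ι] {a : ι → Quiver.Total V}
    [Module.Finite k (BoundAlgebra I)] (hI : IsGeneratedAvoiding I (Set.range a))
    (hA : ∀ α ∈ Set.range a, ∀ β ∈ Set.range a, ∀ x : BoundAlgebra I,
      vertexIdem I β.right * x * vertexIdem I α.left = 0) :
    FGModuleCat.IsCleftExtension
      (RingHom.op (Ideal.Quotient.mk (removedIdeal I a).asIdeal))
      (RingHom.op (removalSection hI)) where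
  map_section x := MulOpposite.unop_injective (mk_removalSection hI x.unop)
  -- Passing to the opposite ring reverses the product, hence the exchanged order of `hy` and `hx`.
  mul_eq_zero _ _ hx hy := MulOpposite.unop_injective
    (mul_eq_zero_of_mem_removedIdeal hA (mem_ker_op_mk.1 hy) (mem_ker_op_mk.1 hx))
  projective := projective_removedIdeal hI hA

end PathAlgebra

theorem mainTheorem4 {k : Type*} [Field k] {V : Type*} [Quiver V] [Fintype V]
    [∀ x y : V, Finite (x ⟶ y)]
    (I : TwoSidedIdeal (PathAlgebra k V)) [PathAlgebra.IsAdmissible I]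
    {t : ℕ} (a : Fin t → Quiver.Total V)
    (ha : ∃ S : Set (PathAlgebra k V), PathAlgebra.IsMinimalGeneratingSet I S ∧
      ∀ r ∈ S, ∀ p ∈ PathAlgebra.paths r, ∀ i, ¬ PathAlgebra.OccursIn (a i) p)
    (hHom : ∀ (i j : Fin t)
      (φ : PathAlgebra.vertexModule I (a i).left →ₗ[(PathAlgebra.BoundAlgebra I)ᵐᵒᵖ]
        PathAlgebra.vertexModule I (a j).right), φ = 0) :
    (igusaTodorovDistance (FGRightModuleCat (PathAlgebra.ArrowRemoval I a)) ≤
        igusaTodorovDistance (FGRightModuleCat (PathAlgebra.BoundAlgebra I)) ∧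
      igusaTodorovDistance (FGRightModuleCat (PathAlgebra.BoundAlgebra I)) ≤
        2 * igusaTodorovDistance (FGRightModuleCat (PathAlgebra.ArrowRemoval I a)) + 1) ∧
    (extensionDimension (FGRightModuleCat (PathAlgebra.ArrowRemoval I a)) ≤
        extensionDimension (FGRightModuleCat (PathAlgebra.BoundAlgebra I)) ∧
      extensionDimension (FGRightModuleCat (PathAlgebra.BoundAlgebra I)) ≤
        2 * extensionDimension (FGRightModuleCat (PathAlgebra.ArrowRemoval I a)) + 1) ∧
    (boundedDerivedDimension (FGRightModuleCat (PathAlgebra.ArrowRemoval I a)) ≤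
        boundedDerivedDimension (FGRightModuleCat (PathAlgebra.BoundAlgebra I)) ∧
      boundedDerivedDimension (FGRightModuleCat (PathAlgebra.BoundAlgebra I)) ≤
        2 * boundedDerivedDimension (FGRightModuleCat (PathAlgebra.ArrowRemoval I a)) + 1) := by
  obtain ⟨S, hS, hSa⟩ := ha
  have hI : PathAlgebra.IsGeneratedAvoiding I (Set.range a) :=
    ⟨S, hS.prop, fun r hr p hp α ⟨i, hi⟩ => hi ▸ hSa r hr p hp i⟩
  have hA : ∀ α ∈ Set.range a, ∀ β ∈ Set.range a, ∀ x : PathAlgebra.BoundAlgebra I,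
      PathAlgebra.vertexIdem I β.right * x * PathAlgebra.vertexIdem I α.left = 0 := by
    rintro _ ⟨i, rfl⟩ _ ⟨j, rfl⟩ x
    exact PathAlgebra.vertexIdem_mul_mul_vertexIdem_eq_zero (hHom i j) x
  have h := PathAlgebra.isCleftExtension_removalSection hI hA
  exact ⟨⟨h.igusaTodorovDistance_le, h.igusaTodorovDistance_le_two_mul⟩,
    ⟨h.extensionDimension_le, h.extensionDimension_le_two_mul⟩,
    ⟨h.boundedDerivedDimension_le, h.boundedDerivedDimension_le_two_mul⟩⟩

end
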